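/- For $x>0$ let $W(x)$ denote the principal branch of the Lambert function, i.e. the unique positive solution $w$ of $we^{w}=x$. For $n\ge 1$ let $X_n$ be the number of blocks of a set partition chosen uniformly at random among all partitions of $\{1,\dots,n\}$ into non-empty blocks, and put $$\mu_n=\frac{n}{W(n)},\qquad \sigma_n=\sqrt{\frac{n}{W(n)(W(n)+1)}},\qquad \Phi(x)=\frac1{\sqrt{2\pi}}\int_{-\infty}^x e^{-t^2/2}\,dt .$$ Then the following two statements hold. (i) (Central limit theorem with rate) As $n\to\infty$, $$\sup_{x\in\mathbb R}\left|\mathbb P\left(\frac{X_n-\mu_n}{\sigma_n}\le x\right)-\Phi(x)\right|=O\left(n^{-1/2}\log n\right).$$ (ii) (Local limit theorem) As $n\to\infty$, $$\mathbb P\left(X_n=\lfloor \mu_n+x\sigma_n\rfloor\right)=\frac{e^{-x^2/2}}{\sqrt{2\pi}\,\sigma_n}\left(1+O\left(\frac{1+|x|^3}{\sigma_n}\right)\right)$$ uniformly for $x=o(\sigma_n^{1/3})$. That is, there is an absolute constant $C$ such that for every real sequence $\varepsilon_n\to0$ there is an $N$ such that, for all $n\ge N$ and all real $x$ with $|x|\le\varepsilon_n\sigma_n^{1/3}$,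 the probability on the left equals $\frac{e^{-x^2/2}}{\sqrt{2\pi}\,\sigma_n}(1+r)$ for some real $r$ with $|r|\le C\,\frac{1+|x|^3}{\sigma_n}$. -/

import Mathlib

open Filter Topology MeasureTheory

/-- The principal branch of the Lambert function: the inverse of `w ↦ w * exp w` on `[-1, ∞)`. -/
noncomputable def lambertW (x : ℝ) : ℝ :=
  Function.invFunOn (fun w : ℝ => w * Real.exp w) (Set.Ici (-1)) x

theorem lambertW_spec {x : ℝ} (hx : -Real.exp (-1) ≤ x) :
    -1 ≤ lambertW x ∧ lambertW x * Real.exp (lambertW x) = x := by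
  have hex : ∃ w ∈ Set.Ici (-1 : ℝ), (fun w : ℝ => w * Real.exp w) w = x := by
    have hc : ContinuousOn (fun w : ℝ => w * Real.exp w) (Set.Icc (-1) (max x 0)) := by fun_prop
    have h1 : (-1 : ℝ) ≤ max x 0 := le_trans (by norm_num) (le_max_right _ _)
    have hm : x ∈ Set.Icc ((fun w : ℝ => w * Real.exp w) (-1))
        ((fun w : ℝ => w * Real.exp w) (max x 0)) := by
      refine ⟨by simpa using hx, ?_⟩
      have h0 : (0 : ℝ) ≤ max x 0 := le_max_right _ _
      have h2 : 1 ≤ Real.exp (max x 0) := Real.one_le_exp h0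
      have h3 : x ≤ max x 0 := le_max_left _ _
      simp only
      nlinarith
    obtain ⟨w, hw, hwx⟩ := intermediate_value_Icc h1 hc hm
    exact ⟨w, hw.1, hwx⟩
  exact ⟨Function.invFunOn_mem hex, Function.invFunOn_eq hex⟩

theorem lambertW_pos {x : ℝ} (hx : 0 < x) : 0 < lambertW x := by
  have h := (lambertW_spec (x := x) (by linarith [Real.exp_pos (-1)])).2
  by_contra hn
  have := mul_nonpos_of_nonpos_of_nonneg (not_lt.mp hn) (Real.exp_pos (lambertW x)).le
  linarith

/-- For positive `x`, `lambertW x` is the only real solution of `w * exp w = x`. -/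
theorem lambertW_unique {x w : ℝ} (hx : 0 < x) (hw : w * Real.exp w = x) : w = lambertW x := by
  have h := (lambertW_spec (x := x) (by linarith [Real.exp_pos (-1)])).2
  have hp := lambertW_pos hx
  have hwp : 0 < w := by
    by_contra hn
    have := mul_nonpos_of_nonpos_of_nonneg (not_lt.mp hn) (Real.exp_pos w).le
    linarith
  rcases lt_trichotomy w (lambertW x) with hl | hl | hl
  · have := mul_lt_mul'' hl (Real.exp_lt_exp.mpr hl) hwp.le (Real.exp_pos _).le
    linarith
  · exact hl
  · have := mul_lt_mul'' hl (Real.exp_lt_exp.mpr hl) hp.le (Real.exp_pos _).le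
    linarith

/-- Set partitions of an `n`-element set into non-empty, pairwise disjoint blocks. -/
abbrev SetPartition (n : ℕ) : Type := Finpartition (Finset.univ : Finset (Fin n))

instance SetPartition.instMeasurableSpace (n : ℕ) : MeasurableSpace (SetPartition n) := ⊤

/-- The uniform probability distribution on the set partitions of an `n`-element set. -/
noncomputable def uniformSetPartition (n : ℕ) : Measure (SetPartition n) :=
  (PMF.uniformOfFintype (SetPartition n)).toMeasure

/-- The random variable `X_n`: the number of blocks of a set partition. -/
def numBlocks (n : ℕ) (π : SetPartition n) : ℕ := π.parts.card

/-- `μ_n = n / W(n)`. -/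
noncomputable def blockMu (n : ℕ) : ℝ := n / lambertW n

/-- `σ_n`, the non-negative square root of `n / (W(n) (W(n) + 1))`. -/
noncomputable def blockSigma (n : ℕ) : ℝ := √(n / (lambertW n * (lambertW n + 1)))

/-- The standard normal distribution function. -/
noncomputable def stdNormalPhi (x : ℝ) : ℝ :=
  1 / √(2 * Real.pi) * ∫ t in Set.Iic x, Real.exp (-t ^ 2 / 2)

theorem stdNormalPhi_mem_Icc (x : ℝ) : stdNormalPhi x ∈ Set.Icc (0 : ℝ) 1 := by
  have hs : 0 < √(2 * Real.pi) := Real.sqrt_pos.mpr (by positivity)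
  have he : (fun t : ℝ => Real.exp (-t ^ 2 / 2)) = fun t => Real.exp (-(1 / 2) * t ^ 2) := by
    funext t; congr 1; ring
  have hi : Integrable (fun t : ℝ => Real.exp (-t ^ 2 / 2)) := by
    rw [he]; exact integrable_exp_neg_mul_sq (by norm_num)
  have hv : ∫ t : ℝ, Real.exp (-t ^ 2 / 2) = √(2 * Real.pi) := by
    rw [he, integral_gaussian]; congr 1; ring
  have hn : 0 ≤ ∫ t in Set.Iic x, Real.exp (-t ^ 2 / 2) :=
    integral_nonneg fun t => (Real.exp_pos _).le
  have hl : ∫ t in Set.Iic x, Real.exp (-t ^ 2 / 2) ≤ √(2 * Real.pi) := by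
    rw [← hv]
    exact setIntegral_le_integral hi (Eventually.of_forall fun t => (Real.exp_pos _).le)
  unfold stdNormalPhi
  refine ⟨by positivity, ?_⟩
  rw [one_div, inv_mul_le_iff₀ hs]
  linarith

/-- The supremum in the Kolmogorov distance is one of a bounded function. -/
theorem bddAbove_range_cdf_sub (n : ℕ) : BddAbove (Set.range fun x : ℝ =>
    |(uniformSetPartition n).real {π | ((numBlocks n π : ℝ) - blockMu n) / blockSigma n ≤ x}
      - stdNormalPhi x|) := by
  have : IsProbabilityMeasure (uniformSetPartition n) := by
    unfold uniformSetPartition; infer_instance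
  refine ⟨1, ?_⟩
  rintro _ ⟨x, rfl⟩
  have h := stdNormalPhi_mem_Icc x
  simp only
  set p := (uniformSetPartition n).real
    {π | ((numBlocks n π : ℝ) - blockMu n) / blockSigma n ≤ x} with hp
  have h0 : 0 ≤ p := measureReal_nonneg
  have h1 : p ≤ 1 := measureReal_le_one
  rw [abs_le]
  constructor <;> linarith [h.1, h.2]

/-!
Write `a k = k ^ n / k!` (`dobinski`) and let `S(n, k)` (`blockCount`) be the number of partitions
of an `n`-element set into `k` blocks. Sorting the maps from an `n`-element set to an `m`-element
set by their partition into fibres gives `a m = ∑ k, S(n, k) / (m - k)!`: the law with weights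
proportional to `a` is the convolution of the law of the number of blocks with a Poisson law.
Inverting, `S(n, k) = ∑ j, (-1) ^ j / j! * a (k - j)` (`blockCount_eq_sum`).

With `r = W(n)`, `μ = exp r = n / r` and `σ² = μ / (r + 1)`, the ratios of consecutive weights
satisfy `a j / a (j + 1) ≤ exp ((j + 1 - μ) / σ²)` and
`a (j + 1) / a j ≤ exp (-(r + 1) (j - μ) / j)`. Summing the logarithms shows that `a` has a
Gaussian profile of centre `μ` and scale `σ`, with relative error `O((1 + |y|³) / σ)` at `k = μ + y σ`
(`IsSaddle.abs_logDefect_sub_le_cube`), and decays exponentially in `|y|` everywhere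
(`IsSaddle.dobinski_le_peak_mul`). No asymptotic formula for factorials is involved, since the
height at the maximum drops out on normalizing.

Near the maximum `a (k - j)` is close to `a k`, so the inversion formula gives
`S(n, k) = exp (-1) * a k * (1 + O((1 + |y|) / σ))`
(`IsSaddle.abs_exp_mul_blockCount_sub_le`), and `S(n, k) ≤ a k` controls the tails. Hence the
suitably scaled `S(n, k)` differ from `exp (-y² / 2)` by at most `O(1 / σ) / (1 + y²)` for all
integers `k` (`IsSaddle.abs_scaledCount_sub_le_cauchyProfile`): where the local estimate fails,
`|y|³ / σ ≥ 1`, so the tails are absorbed in the same bound.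

Comparing sums over the integers with integrals (`abs_tsum_sub_setIntegral_le`), the normalizing sum
is `σ √(2π) + O(1)` and the partial sums are Gaussian integrals up to `O(1)`. Division by the
normalizing sum turns the local estimate into the local limit theorem and the partial sums into the
central limit theorem with error `O(1 / σ)`, and `1 / σ = O(n ^ (-1/2) * log n)` because
`W(n) ≤ log n`.
-/

/-! ### Counting set partitions -/

/-- The number of set partitions of an `n`-element set with exactly `k` blocks
(a Stirling number of the second kind). -/
def blockCount (n k : ℕ) : ℕ := (Finset.univ.filter fun π : SetPartition n => numBlocks n π = k).card

/-- The Dobiński weight `k ^ n / k!`. -/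
noncomputable def dobinski (n k : ℕ) : ℝ := (k : ℝ) ^ n / (k.factorial : ℝ)

theorem finpartition_eq_of_part_eq {n : ℕ} {P Q : SetPartition n}
    (h : ∀ a b, P.part a = P.part b ↔ Q.part a = Q.part b) : P = Q := by
  have hpart : ∀ a, P.part a = Q.part a := by
    intro a
    ext b
    rw [P.mem_part_iff_part_eq_part (Finset.mem_univ _) (Finset.mem_univ _),
      Q.mem_part_iff_part_eq_part (Finset.mem_univ _) (Finset.mem_univ _), h]
  have key : ∀ {P Q : SetPartition n}, (∀ a, P.part a = Q.part a) → P.parts ⊆ Q.parts := by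
    intro P Q hPQ t ht
    obtain ⟨a, ha⟩ := P.nonempty_of_mem_parts ht
    rw [← P.part_eq_of_mem ht ha, hPQ]
    exact Q.part_mem.2 (Finset.mem_univ _)
  exact Finpartition.ext (Finset.Subset.antisymm (key hpart) (key fun a => (hpart a).symm))

open Classical in
/-- The partition of the domain of `f` into its fibres. -/
noncomputable def fibrePartition {n m : ℕ} (f : Fin n → Fin m) : SetPartition n :=
  Finpartition.ofSetoid (Setoid.ker f)

theorem fibrePartition_part_eq_iff {n m : ℕ} (f : Fin n → Fin m) (a b : Fin n) :
    (fibrePartition f).part a = (fibrePartition f).part b ↔ f a = f b := by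
  classical
  rw [← Finpartition.mem_part_iff_part_eq_part _ (Finset.mem_univ _) (Finset.mem_univ _)]
  unfold fibrePartition
  rw [Finpartition.mem_part_ofSetoid_iff_rel, Setoid.ker_def]
  exact eq_comm

theorem fibrePartition_eq_iff {n m : ℕ} (f : Fin n → Fin m) (π : SetPartition n) :
    fibrePartition f = π ↔ ∀ a b, π.part a = π.part b ↔ f a = f b := by
  constructor
  · rintro rfl
    exact fibrePartition_part_eq_iff f
  · intro h
    exact finpartition_eq_of_part_eq fun a b => by rw [fibrePartition_part_eq_iff, h]

/-- The maps whose partition into fibres is `π` correspond to the injections of the set of blocks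
of `π` into the codomain. -/
theorem card_fibrePartition_eq {n m : ℕ} (π : SetPartition n) :
    (Finset.univ.filter fun f : Fin n → Fin m => fibrePartition f = π).card =
      m.descFactorial (numBlocks n π) := by
  classical
  have hcard : Fintype.card (π.parts ↪ Fin m) = m.descFactorial (numBlocks n π) := by
    rw [Fintype.card_embedding_eq]
    simp [numBlocks]
  rw [← hcard, ← Finset.card_univ]
  symm
  refine Finset.card_bij
    (fun e _ a => e ⟨π.part a, π.part_mem.2 (Finset.mem_univ a)⟩) ?_ ?_ ?_
  · intro e _
    rw [Finset.mem_filter]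
    refine ⟨Finset.mem_univ _, (fibrePartition_eq_iff _ _).2 fun a b => ?_⟩
    simp
  · intro e _ e' _ h
    ext ⟨t, ht⟩
    obtain ⟨a, ha⟩ := π.nonempty_of_mem_parts ht
    have := congrFun h a
    simp only [π.part_eq_of_mem ht ha] at this
    rw [this]
  · intro f hf
    rw [Finset.mem_filter] at hf
    have hf := (fibrePartition_eq_iff _ _).1 hf.2
    have hne : ∀ t : π.parts, ∃ a, a ∈ t.1 := fun t => π.nonempty_of_mem_parts t.2
    choose g hg using hne
    refine ⟨⟨fun t => f (g t), fun t t' h => ?_⟩, Finset.mem_univ _, ?_⟩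
    · have := (hf _ _).2 h
      rw [π.part_eq_of_mem t.2 (hg t), π.part_eq_of_mem t'.2 (hg t')] at this
      exact Subtype.ext this
    · funext a
      refine (hf _ _).1 ?_
      exact π.part_eq_of_mem (π.part_mem.2 (Finset.mem_univ a)) (hg ⟨π.part a, _⟩)

theorem pow_eq_sum_descFactorial (n m : ℕ) :
    m ^ n = ∑ π : SetPartition n, m.descFactorial (numBlocks n π) := by
  classical
  have h := Finset.card_eq_sum_card_fiberwise (s := (Finset.univ : Finset (Fin n → Fin m)))
    (t := Finset.univ) (f := fibrePartition) (fun _ _ => Finset.mem_coe.2 (Finset.mem_univ _))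
  simp only [card_fibrePartition_eq] at h
  rw [← h]
  simp

/-- Expansion of the Dobiński weight: the law with weights proportional to `dobinski n` is the
convolution of the law of the number of blocks with the Poisson law of parameter one. -/
theorem dobinski_eq_sum (n m : ℕ) :
    dobinski n m = ∑ π : SetPartition n,
      if numBlocks n π ≤ m then (((m - numBlocks n π).factorial : ℝ))⁻¹ else 0 := by
  have h : ((m : ℝ)) ^ n = ∑ π : SetPartition n, (m.descFactorial (numBlocks n π) : ℝ) := by
    exact_mod_cast pow_eq_sum_descFactorial n m
  unfold dobinski
  rw [h, Finset.sum_div]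
  refine Finset.sum_congr rfl fun π _ => ?_
  split_ifs with hle
  · have h2 := Nat.factorial_mul_descFactorial hle
    have h3 : ((m - numBlocks n π).factorial : ℝ) * (m.descFactorial (numBlocks n π) : ℝ) =
      m.factorial := by exact_mod_cast h2
    have h4 : ((m - numBlocks n π).factorial : ℝ) ≠ 0 := by positivity
    rw [← h3]
    have h5 : (m.descFactorial (numBlocks n π) : ℝ) ≠ 0 := by
      intro h0
      rw [h0, mul_zero] at h3
      exact (Nat.cast_ne_zero.2 (Nat.factorial_ne_zero m)) h3.symm
    field_simp
  · rw [Nat.descFactorial_eq_zero_iff_lt.2 (not_le.1 hle)]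
    simp

/-- The term of the partitions with exactly `k` blocks in `dobinski_eq_sum`. -/
theorem blockCount_le_dobinski (n k : ℕ) : (blockCount n k : ℝ) ≤ dobinski n k := by
  rw [dobinski_eq_sum, blockCount, Finset.card_filter]
  push_cast
  refine Finset.sum_le_sum fun π _ => ?_
  split_ifs with h1 h2 h2
  · simp [h1]
  · exact absurd h1.le h2
  · positivity
  · exact le_rfl

theorem sum_neg_one_pow_div_factorial (d : ℕ) :
    ∑ j ∈ Finset.range (d + 1), (-1 : ℝ) ^ j / (j.factorial : ℝ) * ((d - j).factorial : ℝ)⁻¹ =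
      if d = 0 then 1 else 0 := by
  have h := Int.alternating_sum_range_choose (n := d)
  have h' : ∑ j ∈ Finset.range (d + 1), (-1 : ℝ) ^ j * (d.choose j : ℝ) =
      if d = 0 then 1 else 0 := by exact_mod_cast h
  have h2 : ∑ j ∈ Finset.range (d + 1), (-1 : ℝ) ^ j / (j.factorial : ℝ) *
      ((d - j).factorial : ℝ)⁻¹ = (∑ j ∈ Finset.range (d + 1), (-1 : ℝ) ^ j * (d.choose j : ℝ)) /
        d.factorial := by
    rw [Finset.sum_div]
    refine Finset.sum_congr rfl fun j hj => ?_
    have hjd : j ≤ d := Nat.lt_succ_iff.1 (Finset.mem_range.1 hj)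
    rw [Nat.cast_choose ℝ hjd]
    field_simp
  rw [h2, h']
  split_ifs with h0 <;> simp [h0]

/-- Inversion of `dobinski_eq_sum`, equivalently the inclusion–exclusion formula for the Stirling
numbers of the second kind. -/
theorem blockCount_eq_sum (n k : ℕ) :
    (blockCount n k : ℝ) =
      ∑ j ∈ Finset.range (k + 1), (-1 : ℝ) ^ j / (j.factorial : ℝ) * dobinski n (k - j) := by
  simp only [dobinski_eq_sum, Finset.mul_sum]
  rw [Finset.sum_comm, blockCount, Finset.card_filter]
  push_cast
  refine Finset.sum_congr rfl fun π _ => ?_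
  set b := numBlocks n π
  rcases le_or_gt b k with hb | hb
  · obtain ⟨d, rfl⟩ := Nat.exists_eq_add_of_le hb
    have h := sum_neg_one_pow_div_factorial d
    have h2 : (if b = b + d then (1 : ℝ) else 0) = if d = 0 then 1 else 0 := by
      congr 1
      simp
    rw [h2, ← h]
    have hsub : Finset.range (d + 1) ⊆ Finset.range (b + d + 1) :=
      Finset.range_subset_range.2 (by omega)
    rw [← Finset.sum_subset hsub]
    · refine Finset.sum_congr rfl fun j hj => ?_
      have hj' := Finset.mem_range.1 hj
      rw [if_pos (by omega)]
      congr 4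
      omega
    · intro j hj' hj
      rw [Finset.mem_range] at hj hj'
      rw [if_neg (by omega), mul_zero]
  · rw [if_neg (by omega)]
    symm
    refine Finset.sum_eq_zero fun j _ => ?_
    rw [if_neg (by omega), mul_zero]

theorem numBlocks_le (n : ℕ) (π : SetPartition n) : numBlocks n π ≤ n := by
  simpa [numBlocks] using π.card_parts_le_card

theorem blockCount_eq_zero_of_lt {n k : ℕ} (h : n < k) : blockCount n k = 0 := by
  unfold blockCount
  rw [Finset.card_eq_zero, Finset.filter_eq_empty_iff]
  intro π _ h2
  have := numBlocks_le n π
  omega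

theorem sum_blockCount (n : ℕ) :
    ∑ k ∈ Finset.range (n + 1), blockCount n k = Fintype.card (SetPartition n) := by
  rw [← Finset.card_univ]
  exact (Finset.card_eq_sum_card_fiberwise (f := numBlocks n)
    (fun π _ => Finset.mem_coe.2 (Finset.mem_range.2 (Nat.lt_succ_of_le (numBlocks_le n π))))).symm

open Classical in
theorem uniformSetPartition_real_preimage (n : ℕ) (T : ℕ → Prop) :
    (uniformSetPartition n).real {π | T (numBlocks n π)} =
      (∑ k ∈ (Finset.range (n + 1)).filter T, (blockCount n k : ℝ)) /
        ∑ k ∈ Finset.range (n + 1), (blockCount n k : ℝ) := by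
  have hden : ∑ k ∈ Finset.range (n + 1), (blockCount n k : ℝ) = Fintype.card (SetPartition n) := by
    exact_mod_cast sum_blockCount n
  have hnum : ∑ k ∈ (Finset.range (n + 1)).filter T, (blockCount n k : ℝ) =
      (Finset.univ.filter fun π : SetPartition n => T (numBlocks n π)).card := by
    rw [Finset.card_eq_sum_card_fiberwise (f := numBlocks n) (t := (Finset.range (n + 1)).filter T)]
    · push_cast
      refine Finset.sum_congr rfl fun k hk => ?_
      rw [blockCount, Finset.filter_filter]
      congr 2
      ext π
      simp only [Finset.mem_filter, Finset.mem_univ, true_and]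
      exact ⟨fun h => ⟨h ▸ (Finset.mem_filter.1 hk).2, h⟩, fun h => h.2⟩
    · intro π hπ
      rw [Finset.mem_coe, Finset.mem_filter] at hπ ⊢
      exact ⟨Finset.mem_range.2 (Nat.lt_succ_of_le (numBlocks_le n π)), hπ.2⟩
  rw [hden, hnum, measureReal_def, uniformSetPartition,
    PMF.toMeasure_uniformOfFintype_apply _ (MeasurableSpace.measurableSet_top)]
  rw [ENNReal.toReal_div, ENNReal.toReal_natCast, ENNReal.toReal_natCast]
  congr 2
  rw [← Fintype.card_coe]
  refine Fintype.card_congr (Equiv.subtypeEquivRight fun π => by simp)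

/-! ### Comparison of sums over the integers with integrals -/

/-- The value of `f` at the right end of a unit interval differs from the mean of `f` over the
interval by at most the variation of `f` there. Summed over `k`, this compares sums over the
integers with integrals over the line. -/
theorem abs_sub_integral_le_integral {f f' g : ℝ → ℝ} (hf : ∀ s, HasDerivAt f (f' s) s)
    (hf' : Continuous f') (hg : Continuous g) (hfg : ∀ s, |f' s| ≤ g s) (k : ℤ) :
    |f k - ∫ s in (-1 : ℝ) + k..(-1 : ℝ) + k + 1, f s| ≤
      ∫ s in (-1 : ℝ) + k..(-1 : ℝ) + k + 1, g s := by
  have hfc : Continuous f := continuous_iff_continuousAt.2 fun s => (hf s).continuousAt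
  have hle : (-1 : ℝ) + k ≤ (-1 : ℝ) + k + 1 := by linarith
  have h1 : f k - ∫ s in (-1 : ℝ) + k..(-1 : ℝ) + k + 1, f s =
      ∫ s in (-1 : ℝ) + k..(-1 : ℝ) + k + 1, (f k - f s) := by
    rw [intervalIntegral.integral_sub (by simp) (hfc.intervalIntegrable _ _)]
    simp
  rw [h1, ← Real.norm_eq_abs]
  have hnn : ∀ s, 0 ≤ g s := fun s => (abs_nonneg _).trans (hfg s)
  refine (intervalIntegral.norm_integral_le_of_norm_le_const
    (C := ∫ s in (-1 : ℝ) + k..(-1 : ℝ) + k + 1, g s) ?_).trans (by simp)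
  intro s hs
  rw [Set.uIoc_of_le hle] at hs
  have hsk : s ≤ k := by linarith [hs.2]
  rw [← intervalIntegral.integral_eq_sub_of_hasDerivAt (fun x _ => hf x)
    (hf'.intervalIntegrable _ _)]
  calc ‖∫ x in s..(k : ℝ), f' x‖ ≤ ∫ x in s..(k : ℝ), g x :=
        intervalIntegral.norm_integral_le_of_norm_le hsk
          (Eventually.of_forall fun x _ => hfg x) (hg.intervalIntegrable _ _)
    _ ≤ ∫ s in (-1 : ℝ) + k..(-1 : ℝ) + k + 1, g s :=
        intervalIntegral.integral_mono_interval hs.1.le hsk (by linarith)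
          (Eventually.of_forall hnn) (hg.intervalIntegrable _ _)

/-- The Cauchy profile with centre `μ` and scale `σ`; it dominates all error terms. -/
noncomputable def cauchyProfile (μ σ s : ℝ) : ℝ := (1 + ((s - μ) / σ) ^ 2)⁻¹

/-- The Gaussian profile with centre `μ` and scale `σ`, normalized to have maximum one. -/
noncomputable def gaussProfile (μ σ s : ℝ) : ℝ := Real.exp (-((s - μ) / σ) ^ 2 / 2)

theorem cauchyProfile_pos (μ σ s : ℝ) : 0 < cauchyProfile μ σ s := by
  unfold cauchyProfile; positivity

theorem continuous_cauchyProfile (μ σ : ℝ) : Continuous (cauchyProfile μ σ) := by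
  unfold cauchyProfile
  exact Continuous.inv₀ (by fun_prop) fun s => by positivity

theorem integrable_cauchyProfile (μ : ℝ) {σ : ℝ} (hσ : 0 < σ) :
    Integrable (cauchyProfile μ σ) := by
  have h := (integrable_inv_one_add_sq.comp_div hσ.ne').comp_sub_right μ
  exact h

theorem integral_cauchyProfile (μ : ℝ) {σ : ℝ} (hσ : 0 < σ) :
    ∫ s, cauchyProfile μ σ s = σ * Real.pi := by
  unfold cauchyProfile
  rw [integral_sub_right_eq_self (fun s => (1 + (s / σ) ^ 2)⁻¹) μ,
    Measure.integral_comp_div (fun s => (1 + s ^ 2)⁻¹) σ, integral_univ_inv_one_add_sq,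
    abs_of_pos hσ, smul_eq_mul]

theorem integrable_gaussProfile (μ : ℝ) {σ : ℝ} (hσ : 0 < σ) :
    Integrable (gaussProfile μ σ) := by
  have h0 := integrable_exp_neg_mul_sq (b := 1 / 2) (by norm_num)
  have h := (h0.comp_div hσ.ne').comp_sub_right μ
  refine h.congr (Eventually.of_forall fun s => ?_)
  simp only [gaussProfile]
  congr 1
  ring

theorem setIntegral_gaussProfile (μ : ℝ) {σ : ℝ} (hσ : 0 < σ) (x : ℝ) :
    ∫ s in Set.Iic (μ + x * σ), gaussProfile μ σ s =
      σ * ∫ t in Set.Iic x, Real.exp (-t ^ 2 / 2) := by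
  rw [← integral_indicator measurableSet_Iic, ← integral_indicator measurableSet_Iic]
  have h : (Set.Iic (μ + x * σ)).indicator (gaussProfile μ σ) =
      fun s => (fun u => (Set.Iic x).indicator (fun t => Real.exp (-t ^ 2 / 2)) (u / σ)) (s - μ) := by
    funext s
    have hiff : s ≤ μ + x * σ ↔ (s - μ) / σ ≤ x := by
      rw [div_le_iff₀ hσ]; constructor <;> intro h <;> linarith
    simp only [Set.indicator, Set.mem_Iic, hiff, gaussProfile]
  rw [h, integral_sub_right_eq_self (fun u => (Set.Iic x).indicator _ (u / σ)) μ,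
    Measure.integral_comp_div _ σ, abs_of_pos hσ, smul_eq_mul]

theorem integral_gaussProfile (μ : ℝ) {σ : ℝ} (hσ : 0 < σ) :
    ∫ s, gaussProfile μ σ s = σ * √(2 * Real.pi) := by
  unfold gaussProfile
  rw [integral_sub_right_eq_self (fun s => Real.exp (-(s / σ) ^ 2 / 2)) μ,
    Measure.integral_comp_div (fun s => Real.exp (-s ^ 2 / 2)) σ, abs_of_pos hσ, smul_eq_mul]
  have he : (fun t : ℝ => Real.exp (-t ^ 2 / 2)) = fun t => Real.exp (-(1 / 2) * t ^ 2) := by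
    funext t; congr 1; ring
  rw [he, integral_gaussian]
  congr 2
  ring

theorem hasDerivAt_cauchyProfile (μ σ s : ℝ) :
    HasDerivAt (cauchyProfile μ σ)
      (-(2 * ((s - μ) / σ) * (1 / σ)) / (1 + ((s - μ) / σ) ^ 2) ^ 2) s := by
  have h1 : HasDerivAt (fun s : ℝ => 1 + ((s - μ) / σ) ^ 2) (2 * ((s - μ) / σ) * (1 / σ)) s := by
    have := ((((hasDerivAt_id s).sub_const μ).div_const σ).pow 2).const_add 1
    simpa using this
  exact h1.inv (by positivity)

theorem hasDerivAt_gaussProfile (μ σ s : ℝ) :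
    HasDerivAt (gaussProfile μ σ)
      (Real.exp (-((s - μ) / σ) ^ 2 / 2) * (-(2 * ((s - μ) / σ) * (1 / σ)) / 2)) s := by
  have h1 : HasDerivAt (fun s : ℝ => -((s - μ) / σ) ^ 2 / 2)
      (-(2 * ((s - μ) / σ) * (1 / σ)) / 2) s := by
    have := ((((hasDerivAt_id s).sub_const μ).div_const σ).pow 2).neg.div_const 2
    simpa using this
  exact h1.exp

theorem abs_mul_exp_neg_sq_le (y : ℝ) : |y| * Real.exp (-y ^ 2 / 2) ≤ 8 * (1 + y ^ 2)⁻¹ := by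
  have h1 := Real.quadratic_le_exp_of_nonneg (x := y ^ 2 / 2) (by positivity)
  have h2 : |y| * (1 + y ^ 2) ≤ 8 * Real.exp (y ^ 2 / 2) := by
    have : |y| ≤ 1 + y ^ 2 := by rw [← sq_abs]; nlinarith [sq_nonneg (|y| - 1), abs_nonneg y]
    nlinarith [sq_nonneg y]
  rw [show -y ^ 2 / 2 = -(y ^ 2 / 2) by ring, Real.exp_neg, ← div_eq_mul_inv, ← div_eq_mul_inv,
    div_le_div_iff₀ (Real.exp_pos _) (by positivity)]
  exact h2

theorem abs_deriv_cauchyProfile_le (μ : ℝ) {σ : ℝ} (hσ : 0 < σ) (s : ℝ) :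
    |-(2 * ((s - μ) / σ) * (1 / σ)) / (1 + ((s - μ) / σ) ^ 2) ^ 2| ≤
      1 / σ * cauchyProfile μ σ s := by
  unfold cauchyProfile
  set y := (s - μ) / σ
  have hy : 2 * |y| ≤ 1 + y ^ 2 := by
    rw [← sq_abs]; nlinarith [sq_nonneg (|y| - 1)]
  have h : |-(2 * y * (1 / σ)) / (1 + y ^ 2) ^ 2| = 1 / σ * (2 * |y| / (1 + y ^ 2) ^ 2) := by
    rw [abs_div, abs_neg, abs_mul, abs_mul, abs_of_pos (one_div_pos.2 hσ), abs_two,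
      abs_of_pos (by positivity : (0 : ℝ) < (1 + y ^ 2) ^ 2)]
    ring
  rw [h]
  refine mul_le_mul_of_nonneg_left ?_ (by positivity)
  rw [div_le_iff₀ (by positivity)]
  calc 2 * |y| ≤ 1 + y ^ 2 := hy
    _ = (1 + y ^ 2)⁻¹ * (1 + y ^ 2) ^ 2 := by field_simp

theorem abs_deriv_gaussProfile_le (μ : ℝ) {σ : ℝ} (hσ : 0 < σ) (s : ℝ) :
    |Real.exp (-((s - μ) / σ) ^ 2 / 2) * (-(2 * ((s - μ) / σ) * (1 / σ)) / 2)| ≤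
      8 / σ * cauchyProfile μ σ s := by
  unfold cauchyProfile
  set y := (s - μ) / σ
  have h : |Real.exp (-y ^ 2 / 2) * (-(2 * y * (1 / σ)) / 2)| =
      1 / σ * (|y| * Real.exp (-y ^ 2 / 2)) := by
    rw [show Real.exp (-y ^ 2 / 2) * (-(2 * y * (1 / σ)) / 2) =
      -(1 / σ * (y * Real.exp (-y ^ 2 / 2))) by ring, abs_neg, abs_mul, abs_mul,
      abs_of_pos (one_div_pos.2 hσ), abs_of_pos (Real.exp_pos _)]
  rw [h]
  calc 1 / σ * (|y| * Real.exp (-y ^ 2 / 2)) ≤ 1 / σ * (8 * (1 + y ^ 2)⁻¹) :=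
        mul_le_mul_of_nonneg_left (abs_mul_exp_neg_sq_le y) (by positivity)
    _ = _ := by ring

/-- The Cauchy profile sums over the integers to `O(σ)`. -/
theorem summable_cauchyProfile (μ : ℝ) {σ : ℝ} (hσ : 1 ≤ σ) :
    Summable (fun k : ℤ => cauchyProfile μ σ k) ∧
      ∑' k : ℤ, cauchyProfile μ σ k ≤ 2 * Real.pi * σ := by
  have hσ0 : 0 < σ := by linarith
  have hI := ((integrable_cauchyProfile μ hσ0).hasSum_intervalIntegral (-1)).mul_left (1 + 1 / σ)
  rw [integral_cauchyProfile μ hσ0] at hI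
  have hle : ∀ k : ℤ, cauchyProfile μ σ k ≤
      (1 + 1 / σ) * ∫ s in (-1 : ℝ) + k..(-1 : ℝ) + k + 1, cauchyProfile μ σ s := by
    intro k
    have hc : Continuous fun s : ℝ =>
        -(2 * ((s - μ) / σ) * (1 / σ)) / (1 + ((s - μ) / σ) ^ 2) ^ 2 :=
      Continuous.div (by fun_prop) (by fun_prop) fun s => by positivity
    have h := abs_sub_integral_le_integral (g := fun s => 1 / σ * cauchyProfile μ σ s)
      (hasDerivAt_cauchyProfile μ σ) hc
      (continuous_const.mul (continuous_cauchyProfile μ σ)) (abs_deriv_cauchyProfile_le μ hσ0) k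
    rw [intervalIntegral.integral_const_mul] at h
    have := (abs_le.1 h).2
    linarith
  have hs := Summable.of_nonneg_of_le (fun k : ℤ => (cauchyProfile_pos μ σ k).le) hle hI.summable
  refine ⟨hs, (hs.tsum_le_tsum hle hI.summable).trans ?_⟩
  rw [hI.tsum_eq]
  have : (1 + 1 / σ) * (σ * Real.pi) = Real.pi * (σ + 1) := by field_simp
  rw [this]
  nlinarith [Real.pi_pos]

/-- If `v` is within `O(1 / σ)` of the Gaussian profile, with a summable weight, then its partial
sums agree with the Gaussian integrals up to `O(1)`. The predicate `P` selects the range of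
summation and `U` the corresponding range of integration. -/
theorem abs_tsum_sub_setIntegral_le {μ σ B : ℝ} (hσ : 1 ≤ σ) (hB : 0 ≤ B) {v : ℤ → ℝ}
    (hv : ∀ k : ℤ, |v k - gaussProfile μ σ k| ≤ B / σ * cauchyProfile μ σ k)
    (P : ℤ → Prop) [DecidablePred P] {U : Set ℝ} (hU : MeasurableSet U)
    (hPU : ∀ k : ℤ, P k → Set.Ioc ((-1 : ℝ) + k) ((-1 : ℝ) + k + 1) ⊆ U)
    (hPU' : ∀ k : ℤ, ¬ P k → Disjoint (Set.Ioc ((-1 : ℝ) + k) ((-1 : ℝ) + k + 1)) U) :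
    |(∑' k : ℤ, if P k then v k else 0) - ∫ s in U, gaussProfile μ σ s| ≤
      (2 * B + 8) * Real.pi := by
  have hσ0 : 0 < σ := by linarith
  have hG := integrable_gaussProfile μ hσ0
  have hI := (hG.indicator hU).hasSum_intervalIntegral (-1)
  rw [integral_indicator hU] at hI
  have hIk : ∀ k : ℤ, ∫ s in (-1 : ℝ) + k..(-1 : ℝ) + k + 1, U.indicator (gaussProfile μ σ) s =
      if P k then ∫ s in (-1 : ℝ) + k..(-1 : ℝ) + k + 1, gaussProfile μ σ s else 0 := by
    intro k
    have hle : (-1 : ℝ) + k ≤ (-1 : ℝ) + k + 1 := by linarith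
    rw [intervalIntegral.integral_of_le hle, intervalIntegral.integral_of_le hle]
    split_ifs with h
    · exact setIntegral_congr_fun measurableSet_Ioc fun s hs =>
        Set.indicator_of_mem (hPU k h hs) _
    · rw [setIntegral_congr_fun (g := fun _ => (0 : ℝ)) measurableSet_Ioc fun s hs =>
        Set.indicator_of_notMem (fun hsU => (Set.disjoint_left.1 (hPU' k h)) hs hsU) _]
      simp
  simp only [hIk] at hI
  obtain ⟨hcs, hct⟩ := summable_cauchyProfile μ hσ
  have hJ := ((integrable_cauchyProfile μ hσ0).hasSum_intervalIntegral (-1)).mul_left (8 / σ)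
  rw [integral_cauchyProfile μ hσ0] at hJ
  have hD := (hcs.hasSum.mul_left (B / σ)).add hJ
  have hterm : ∀ k : ℤ, ‖(if P k then v k else 0) -
      (if P k then ∫ s in (-1 : ℝ) + k..(-1 : ℝ) + k + 1, gaussProfile μ σ s else 0)‖ ≤
      B / σ * cauchyProfile μ σ k +
        8 / σ * ∫ s in (-1 : ℝ) + k..(-1 : ℝ) + k + 1, cauchyProfile μ σ s := by
    intro k
    have hc : Continuous fun s : ℝ =>
        Real.exp (-((s - μ) / σ) ^ 2 / 2) * (-(2 * ((s - μ) / σ) * (1 / σ)) / 2) := by fun_prop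
    have h := abs_sub_integral_le_integral (g := fun s => 8 / σ * cauchyProfile μ σ s)
      (hasDerivAt_gaussProfile μ σ) hc
      (continuous_const.mul (continuous_cauchyProfile μ σ)) (abs_deriv_gaussProfile_le μ hσ0) k
    rw [intervalIntegral.integral_const_mul] at h
    have h' := hv k
    have habs := abs_sub_le (v k) (gaussProfile μ σ k)
      (∫ s in (-1 : ℝ) + k..(-1 : ℝ) + k + 1, gaussProfile μ σ s)
    rw [Real.norm_eq_abs]
    split_ifs
    · linarith
    · rw [sub_zero, abs_zero]
      exact add_nonneg ((abs_nonneg _).trans h') ((abs_nonneg _).trans h)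
  have hbound := tsum_of_norm_bounded hD hterm
  have hsd : Summable fun k : ℤ => (if P k then v k else 0) -
      (if P k then ∫ s in (-1 : ℝ) + k..(-1 : ℝ) + k + 1, gaussProfile μ σ s else 0) :=
    Summable.of_norm_bounded hD.summable hterm
  have hsv : Summable fun k : ℤ => if P k then v k else 0 := by
    have := hsd.add hI.summable
    refine this.congr fun k => by ring
  rw [hsv.tsum_sub hI.summable, hI.tsum_eq, Real.norm_eq_abs] at hbound
  refine hbound.trans ?_
  have h1 : B / σ * ∑' k : ℤ, cauchyProfile μ σ k ≤ B / σ * (2 * Real.pi * σ) :=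
    mul_le_mul_of_nonneg_left hct (by positivity)
  have h2 : B / σ * (2 * Real.pi * σ) + 8 / σ * (σ * Real.pi) = (2 * B + 8) * Real.pi := by
    field_simp
  linarith

/-- Partial sums: the integral runs up to `t` rather than `⌊t⌋`, which costs at most one. -/
theorem abs_tsum_le_sub_setIntegral_le {μ σ B : ℝ} (hσ : 1 ≤ σ) (hB : 0 ≤ B) {v : ℤ → ℝ}
    (hv : ∀ k : ℤ, |v k - gaussProfile μ σ k| ≤ B / σ * cauchyProfile μ σ k) (t : ℝ) :
    |(∑' k : ℤ, if (k : ℝ) ≤ t then v k else 0) - ∫ s in Set.Iic t, gaussProfile μ σ s| ≤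
      (2 * B + 8) * Real.pi + 1 := by
  classical
  have hσ0 : 0 < σ := by linarith
  have hG := integrable_gaussProfile μ hσ0
  have h := abs_tsum_sub_setIntegral_le hσ hB hv (fun k => (k : ℝ) ≤ t)
    (U := Set.Iic (⌊t⌋ : ℝ)) measurableSet_Iic
    (fun k hk s hs => by
      have : (k : ℝ) ≤ ⌊t⌋ := by exact_mod_cast Int.le_floor.2 hk
      exact Set.mem_Iic.2 (by linarith [hs.2]))
    (fun k hk => Set.disjoint_left.2 fun s hs hsU => by
      have h1 : ⌊t⌋ < k := Int.floor_lt.2 (not_le.1 hk)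
      have : (⌊t⌋ : ℝ) + 1 ≤ k := by exact_mod_cast h1
      linarith [hs.1, Set.mem_Iic.1 hsU])
  have h2 := intervalIntegral.integral_Iic_sub_Iic (hG.integrableOn (s := Set.Iic (⌊t⌋ : ℝ)))
    (hG.integrableOn (s := Set.Iic t))
  have h3 : |∫ s in (⌊t⌋ : ℝ)..t, gaussProfile μ σ s| ≤ 1 := by
    have := intervalIntegral.norm_integral_le_of_norm_le_const (a := (⌊t⌋ : ℝ)) (b := t)
      (f := gaussProfile μ σ) (C := 1) fun s _ => by
        rw [Real.norm_eq_abs, gaussProfile, abs_of_pos (Real.exp_pos _), Real.exp_le_one_iff]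
        nlinarith [sq_nonneg ((s - μ) / σ)]
    rw [Real.norm_eq_abs, one_mul, abs_of_nonneg (a := t - ⌊t⌋) (by linarith [Int.floor_le t])] at this
    linarith [Int.lt_floor_add_one t]
  rw [abs_le] at h h3 ⊢
  constructor <;> linarith [h.1, h.2, h3.1, h3.2]

theorem abs_tsum_sub_sigma_le {μ σ B : ℝ} (hσ : 1 ≤ σ) (hB : 0 ≤ B) {v : ℤ → ℝ}
    (hv : ∀ k : ℤ, |v k - gaussProfile μ σ k| ≤ B / σ * cauchyProfile μ σ k) :
    |∑' k : ℤ, v k - σ * √(2 * Real.pi)| ≤ (2 * B + 8) * Real.pi := by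
  have h := abs_tsum_sub_setIntegral_le hσ hB hv (fun _ => True) (U := Set.univ)
    MeasurableSet.univ (fun _ _ => Set.subset_univ _) (fun _ h => absurd trivial h)
  rw [setIntegral_univ, integral_gaussProfile μ (by linarith)] at h
  simpa using h

/-! ### The Dobiński weights near their maximum -/

/-- The relations between `n`, the saddle point `r = W(n)`, the centre `μ = n / r` and the scale
`σ`, in the range where `r` and `σ` are not small. -/
structure IsSaddle (n : ℕ) (r μ σ : ℝ) : Prop where
  one_le_r : 1 ≤ r
  four_le_sigma : 4 ≤ σ
  mu_eq_exp : μ = Real.exp r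
  mu_eq : μ = σ ^ 2 * (r + 1)
  n_eq : (n : ℝ) = r * μ

namespace IsSaddle

variable {n : ℕ} {r μ σ : ℝ}

theorem mu_pos (h : IsSaddle n r μ σ) : 0 < μ := h.mu_eq_exp ▸ Real.exp_pos r

theorem two_mul_sq_le_mu (h : IsSaddle n r μ σ) : 2 * σ ^ 2 ≤ μ := by
  have := h.one_le_r
  rw [h.mu_eq]
  nlinarith [sq_nonneg σ]

theorem thirty_two_le_mu (h : IsSaddle n r μ σ) : 32 ≤ μ := by
  have := h.two_mul_sq_le_mu
  have := h.four_le_sigma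
  nlinarith

theorem n_pos (h : IsSaddle n r μ σ) : 0 < n := by
  have h1 : (0 : ℝ) < n := by
    rw [h.n_eq]
    exact mul_pos (by linarith [h.one_le_r]) h.mu_pos
  exact_mod_cast h1

theorem div_mu (h : IsSaddle n r μ σ) (x : ℝ) : (r + 1) * x / μ = x / σ ^ 2 := by
  have h1 : 0 < r + 1 := by linarith [h.one_le_r]
  have h2 : 0 < σ := by linarith [h.four_le_sigma]
  rw [h.mu_eq]
  field_simp

/-- Taken at `t = j + 1`, the left side bounds `dobinski n j / dobinski n (j + 1)`. The inequality
is the sum of `log (t / μ) ≤ t / μ - 1` and `μ / t + t / μ ≥ 2`, the latter weighted by `r`. -/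
theorem mul_exp_neg_le (h : IsSaddle n r μ σ) {t : ℝ} (ht : 0 < t) :
    t * Real.exp (-(n / t)) ≤ Real.exp ((t - μ) / σ ^ 2) := by
  have hμ := h.mu_pos
  have hr := h.one_le_r
  have h1 : t ≤ Real.exp (r + (t / μ - 1)) := by
    have := Real.add_one_le_exp (t / μ - 1)
    rw [Real.exp_add, ← h.mu_eq_exp]
    calc t = μ * (t / μ - 1 + 1) := by field_simp; ring
      _ ≤ μ * Real.exp (t / μ - 1) := mul_le_mul_of_nonneg_left this hμ.le
  calc t * Real.exp (-(n / t)) ≤ Real.exp (r + (t / μ - 1)) * Real.exp (-(n / t)) :=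
        mul_le_mul_of_nonneg_right h1 (Real.exp_pos _).le
    _ = Real.exp (r + (t / μ - 1) - n / t) := by rw [← Real.exp_add]; rfl
    _ ≤ Real.exp ((t - μ) / σ ^ 2) := by
        refine Real.exp_le_exp.2 ?_
        rw [← h.div_mu, h.n_eq]
        have h2 : 2 - t / μ ≤ μ / t := by
          rw [sub_le_iff_le_add, div_add_div _ _ ht.ne' hμ.ne', le_div_iff₀ (by positivity)]
          nlinarith [sq_nonneg (μ - t)]
        have h3 : (r + 1) * (t - μ) / μ = (r + 1) * (t / μ - 1) := by field_simp
        have h4 : r * μ / t = r * (μ / t) := by ring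
        rw [h3, h4]
        nlinarith

/-- Taken at `t = j`, the left side bounds `dobinski n (j + 1) / dobinski n j`. The inequality is
`log (μ / t) ≤ μ / t - 1`. -/
theorem exp_div_le (h : IsSaddle n r μ σ) (t : ℝ) :
    Real.exp (n / t) / t ≤ Real.exp ((r + 1) * (μ / t - 1)) := by
  have hμ := h.mu_pos
  have h1 : μ / t ≤ Real.exp (μ / t - 1) := by
    linarith [Real.add_one_le_exp (μ / t - 1)]
  have h2 : 1 / t ≤ Real.exp (μ / t - 1 - r) := by
    rw [Real.exp_sub, ← h.mu_eq_exp, le_div_iff₀ hμ]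
    calc 1 / t * μ = μ / t := by ring
      _ ≤ _ := h1
  calc Real.exp (n / t) / t = Real.exp (n / t) * (1 / t) := by ring
    _ ≤ Real.exp (n / t) * Real.exp (μ / t - 1 - r) :=
        mul_le_mul_of_nonneg_left h2 (Real.exp_pos _).le
    _ = Real.exp ((r + 1) * (μ / t - 1)) := by
        rw [← Real.exp_add, h.n_eq]
        congr 1
        ring

theorem dobinski_le_succ (h : IsSaddle n r μ σ) (j : ℕ) :
    dobinski n j ≤ dobinski n (j + 1) * Real.exp ((j + 1 - μ) / σ ^ 2) := by
  have ht : (0 : ℝ) < j + 1 := by positivity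
  have h1 := h.mul_exp_neg_le ht
  have h2 : (j : ℝ) ^ n ≤ (j + 1) ^ n * Real.exp (-(n / (j + 1))) := by
    have h3 : (j : ℝ) ≤ (j + 1) * Real.exp (-(1 / (j + 1))) := by
      have h4 := Real.add_one_le_exp (-(1 / ((j : ℝ) + 1)))
      calc (j : ℝ) = (j + 1) * (-(1 / ((j : ℝ) + 1)) + 1) := by field_simp; ring
        _ ≤ _ := mul_le_mul_of_nonneg_left h4 ht.le
    calc (j : ℝ) ^ n ≤ ((j + 1) * Real.exp (-(1 / (j + 1)))) ^ n :=
          pow_le_pow_left₀ (by positivity) h3 n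
      _ = _ := by
        rw [mul_pow, ← Real.exp_nat_mul]
        congr 2
        ring
  unfold dobinski
  rw [Nat.factorial_succ]
  push_cast
  calc (j : ℝ) ^ n / j.factorial ≤ ((j + 1) ^ n * Real.exp (-(n / (j + 1)))) / j.factorial := by
        gcongr
    _ = (j + 1) ^ n / ((j + 1) * j.factorial) * ((j + 1) * Real.exp (-(n / (j + 1)))) := by
        field_simp
    _ ≤ _ := by gcongr

theorem dobinski_succ_le (h : IsSaddle n r μ σ) {j : ℕ} (hj : 0 < j) :
    dobinski n (j + 1) ≤ dobinski n j * Real.exp ((r + 1) * (μ / j - 1)) := by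
  have ht : (0 : ℝ) < j := by exact_mod_cast hj
  have h1 := h.exp_div_le j
  have h2 : ((j : ℝ) + 1) ^ n ≤ j ^ n * Real.exp (n / j) := by
    have h3 : (j : ℝ) + 1 ≤ j * Real.exp (1 / j) := by
      have h4 := Real.add_one_le_exp (1 / (j : ℝ))
      calc (j : ℝ) + 1 = j * (1 / (j : ℝ) + 1) := by field_simp; ring
        _ ≤ _ := mul_le_mul_of_nonneg_left h4 ht.le
    calc ((j : ℝ) + 1) ^ n ≤ (j * Real.exp (1 / j)) ^ n :=
          pow_le_pow_left₀ (by positivity) h3 n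
      _ = _ := by
        rw [mul_pow, ← Real.exp_nat_mul]
        congr 2
        ring
  unfold dobinski
  rw [Nat.factorial_succ]
  push_cast
  calc ((j : ℝ) + 1) ^ n / ((j + 1) * j.factorial) ≤
        (j ^ n * Real.exp (n / j)) / (j * j.factorial) := by
        gcongr
        linarith
    _ = j ^ n / j.factorial * (Real.exp (n / j) / j) := by
        field_simp
    _ ≤ _ := by gcongr

end IsSaddle

theorem dobinski_nonneg (n k : ℕ) : 0 ≤ dobinski n k := by
  unfold dobinski; positivity

theorem dobinski_pos (n : ℕ) {k : ℕ} (hk : 0 < k) : 0 < dobinski n k := by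
  unfold dobinski; positivity

/-- The deviation of the logarithm of the Dobiński weights from a parabola. -/
noncomputable def logDefect (n : ℕ) (μ σ : ℝ) (k : ℕ) : ℝ :=
  Real.log (dobinski n k) + (k - μ) ^ 2 / (2 * σ ^ 2)

/-- The approximate height of the Dobiński weights at their maximum. -/
noncomputable def peak (n : ℕ) (μ σ : ℝ) : ℝ := Real.exp (logDefect n μ σ ⌊μ⌋₊)

theorem peak_pos (n : ℕ) (μ σ : ℝ) : 0 < peak n μ σ := Real.exp_pos _

theorem dobinski_eq_peak_mul (n : ℕ) (μ : ℝ) {σ : ℝ} (hσ : 0 < σ) {k : ℕ} (hk : 0 < k) :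
    dobinski n k = peak n μ σ *
      Real.exp (logDefect n μ σ k - logDefect n μ σ ⌊μ⌋₊) * gaussProfile μ σ k := by
  rw [peak, gaussProfile, ← Real.exp_add, ← Real.exp_add, logDefect, logDefect]
  have : Real.log (dobinski n ⌊μ⌋₊) + ((⌊μ⌋₊ : ℝ) - μ) ^ 2 / (2 * σ ^ 2) +
      (Real.log (dobinski n k) + ((k : ℝ) - μ) ^ 2 / (2 * σ ^ 2) -
        (Real.log (dobinski n ⌊μ⌋₊) + ((⌊μ⌋₊ : ℝ) - μ) ^ 2 / (2 * σ ^ 2))) +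
      -(((k : ℝ) - μ) / σ) ^ 2 / 2 = Real.log (dobinski n k) := by
    field_simp
    ring
  rw [this, Real.exp_log (dobinski_pos n hk)]

theorem abs_sub_le_of_abs_succ_sub_le {φ : ℕ → ℝ} {D : ℝ} {a b : ℕ} (hab : a ≤ b)
    (h : ∀ j, a ≤ j → j < b → |φ (j + 1) - φ j| ≤ D) : |φ b - φ a| ≤ (b - a) * D := by
  induction b, hab using Nat.le_induction with
  | base => simp
  | succ b hab ih =>
    have h1 := ih fun j hj hjb => h j hj (by omega)
    have h2 := h b hab (by omega)
    have h3 := abs_sub_le (φ (b + 1)) (φ b) (φ a)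
    push_cast
    linarith

namespace IsSaddle

variable {n : ℕ} {r μ σ : ℝ}

theorem log_dobinski_le_succ (h : IsSaddle n r μ σ) {j : ℕ} (hj : 0 < j) :
    Real.log (dobinski n j) ≤ Real.log (dobinski n (j + 1)) + (j + 1 - μ) / σ ^ 2 := by
  have h1 := Real.log_le_log (dobinski_pos n hj) (h.dobinski_le_succ j)
  rwa [Real.log_mul (dobinski_pos n (Nat.succ_pos j)).ne' (Real.exp_pos _).ne', Real.log_exp] at h1

theorem log_dobinski_succ_le (h : IsSaddle n r μ σ) {j : ℕ} (hj : 0 < j) :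
    Real.log (dobinski n (j + 1)) ≤ Real.log (dobinski n j) + (r + 1) * (μ / j - 1) := by
  have h1 := Real.log_le_log (dobinski_pos n (Nat.succ_pos j)) (h.dobinski_succ_le hj)
  rwa [Real.log_mul (dobinski_pos n hj).ne' (Real.exp_pos _).ne', Real.log_exp] at h1

theorem neg_le_logDefect_succ_sub (h : IsSaddle n r μ σ) {j : ℕ} (hj : 0 < j) :
    -(1 / (2 * σ ^ 2)) ≤ logDefect n μ σ (j + 1) - logDefect n μ σ j := by
  have h1 := h.log_dobinski_le_succ hj
  have hσ : 0 < σ := by linarith [h.four_le_sigma]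
  unfold logDefect
  push_cast
  have h2 : ((j : ℝ) + 1 - μ) ^ 2 / (2 * σ ^ 2) - (j - μ) ^ 2 / (2 * σ ^ 2) =
      (j + 1 - μ) / σ ^ 2 - 1 / (2 * σ ^ 2) := by
    field_simp
    ring
  linarith

theorem logDefect_succ_sub_le (h : IsSaddle n r μ σ) {j : ℕ} (hj : μ / 2 ≤ j) :
    logDefect n μ σ (j + 1) - logDefect n μ σ j ≤
      1 / (2 * σ ^ 2) + (j - μ) ^ 2 / (σ ^ 2) ^ 2 := by
  have hμ := h.mu_pos
  have hj0 : (0 : ℝ) < j := by linarith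
  have hj0' : 0 < j := by exact_mod_cast hj0
  have h1 := h.log_dobinski_succ_le hj0'
  have hσ : 0 < σ := by linarith [h.four_le_sigma]
  have hr : 0 < r + 1 := by linarith [h.one_le_r]
  have hj2 : σ ^ 2 ≤ j := by linarith [h.two_mul_sq_le_mu]
  unfold logDefect
  push_cast
  have h2 : ((j : ℝ) + 1 - μ) ^ 2 / (2 * σ ^ 2) - (j - μ) ^ 2 / (2 * σ ^ 2) =
      (j - μ) / σ ^ 2 + 1 / (2 * σ ^ 2) := by
    field_simp
    ring
  have h3 : (r + 1) * (μ / j - 1) + (j - μ) / σ ^ 2 = (j - μ) ^ 2 / (σ ^ 2 * j) := by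
    have h4 : r + 1 = μ / σ ^ 2 := by rw [h.mu_eq]; field_simp
    rw [h4]
    field_simp
    ring
  have h5 : ((j : ℝ) - μ) ^ 2 / (σ ^ 2 * j) ≤ (j - μ) ^ 2 / (σ ^ 2) ^ 2 := by
    rw [sq (σ ^ 2)]
    gcongr
  linarith

theorem floor_mu_bounds (h : IsSaddle n r μ σ) :
    (⌊μ⌋₊ : ℝ) ≤ μ ∧ μ - 1 < ⌊μ⌋₊ ∧ 0 < ⌊μ⌋₊ ∧ μ / 2 ≤ ⌊μ⌋₊ := by
  have h1 := Nat.floor_le h.mu_pos.le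
  have h2 := Nat.lt_floor_add_one μ
  have h3 := h.thirty_two_le_mu
  refine ⟨h1, by linarith, ?_, by linarith⟩
  have : (0 : ℝ) < ⌊μ⌋₊ := by linarith
  exact_mod_cast this

theorem abs_logDefect_sub_le (h : IsSaddle n r μ σ) {k : ℕ} (hk : μ / 2 ≤ k) :
    |logDefect n μ σ k - logDefect n μ σ ⌊μ⌋₊| ≤
      (|(k : ℝ) - μ| + 1) * (1 / (2 * σ ^ 2) + (|(k : ℝ) - μ| + 1) ^ 2 / (σ ^ 2) ^ 2) := by
  obtain ⟨hf1, hf2, hf3, hf4⟩ := h.floor_mu_bounds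
  have hσ : 0 < σ := by linarith [h.four_le_sigma]
  set D := 1 / (2 * σ ^ 2) + (|(k : ℝ) - μ| + 1) ^ 2 / (σ ^ 2) ^ 2 with hD
  have hD0 : 0 ≤ D := by positivity
  have hstep : ∀ j : ℕ, μ / 2 ≤ j → |(j : ℝ) - μ| ≤ |(k : ℝ) - μ| + 1 →
      |logDefect n μ σ (j + 1) - logDefect n μ σ j| ≤ D := by
    intro j hj hjk
    have hj0 : (0 : ℝ) < j := by linarith [h.mu_pos]
    have h1 := h.neg_le_logDefect_succ_sub (j := j) (by exact_mod_cast hj0)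
    have h2 := h.logDefect_succ_sub_le hj
    have h3 : ((j : ℝ) - μ) ^ 2 / (σ ^ 2) ^ 2 ≤ (|(k : ℝ) - μ| + 1) ^ 2 / (σ ^ 2) ^ 2 := by
      rw [← sq_abs ((j : ℝ) - μ)]
      gcongr
    have h4 : 0 ≤ (|(k : ℝ) - μ| + 1) ^ 2 / (σ ^ 2) ^ 2 := by positivity
    rw [abs_le]
    constructor <;> linarith
  rcases le_total ⌊μ⌋₊ k with hle | hle
  · refine (abs_sub_le_of_abs_succ_sub_le hle fun j hj hjk => hstep j ?_ ?_).trans ?_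
    · have : (⌊μ⌋₊ : ℝ) ≤ j := by exact_mod_cast hj
      linarith
    · have h1 : (⌊μ⌋₊ : ℝ) ≤ j := by exact_mod_cast hj
      have h2 : (j : ℝ) ≤ k := by exact_mod_cast hjk.le
      rw [abs_le]
      constructor <;> linarith [le_abs_self ((k : ℝ) - μ), abs_nonneg ((k : ℝ) - μ)]
    · refine mul_le_mul_of_nonneg_right ?_ hD0
      linarith [le_abs_self ((k : ℝ) - μ)]
  · rw [abs_sub_comm]
    refine (abs_sub_le_of_abs_succ_sub_le hle fun j hj hjk => hstep j ?_ ?_).trans ?_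
    · have : (k : ℝ) ≤ j := by exact_mod_cast hj
      linarith
    · have h1 : (k : ℝ) ≤ j := by exact_mod_cast hj
      have h2 : (j : ℝ) ≤ ⌊μ⌋₊ := by exact_mod_cast hjk.le
      rw [abs_le]
      constructor <;> linarith [neg_abs_le ((k : ℝ) - μ), abs_nonneg ((k : ℝ) - μ)]
    · refine mul_le_mul_of_nonneg_right ?_ hD0
      linarith [neg_abs_le ((k : ℝ) - μ)]

/-- Near the maximum, the Dobiński weights are Gaussian up to a factor `exp (O((1 + |y|³) / σ))`,
where `y = (k - μ) / σ`. -/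
theorem abs_logDefect_sub_le_cube (h : IsSaddle n r μ σ) {k : ℕ} (hk : μ / 2 ≤ k) :
    |logDefect n μ σ k - logDefect n μ σ ⌊μ⌋₊| ≤ 5 * ((1 + |((k : ℝ) - μ) / σ| ^ 3) / σ) := by
  have hσ4 := h.four_le_sigma
  have hσ : 0 < σ := by linarith
  refine (h.abs_logDefect_sub_le hk).trans ?_
  rw [abs_div, abs_of_pos hσ]
  set z := |(k : ℝ) - μ| / σ with hz
  have hz0 : 0 ≤ z := by positivity
  have hzσ : |(k : ℝ) - μ| = z * σ := by rw [hz]; field_simp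
  rw [hzσ]
  have h1 : z * σ + 1 ≤ (z + 1) * σ := by nlinarith
  have h0 : 0 ≤ z * σ + 1 := by positivity
  calc (z * σ + 1) * (1 / (2 * σ ^ 2) + (z * σ + 1) ^ 2 / (σ ^ 2) ^ 2)
      ≤ ((z + 1) * σ) * (1 / (2 * σ ^ 2) + ((z + 1) * σ) ^ 2 / (σ ^ 2) ^ 2) := by gcongr
    _ = ((z + 1) / 2 + (z + 1) ^ 3) / σ := by field_simp
    _ ≤ (5 * (1 + z ^ 3)) / σ := by
        refine div_le_div_of_nonneg_right ?_ hσ.le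
        nlinarith [mul_nonneg (add_nonneg zero_le_one hz0) (sq_nonneg (z - 1)), pow_nonneg hz0 3]
    _ = _ := by ring

theorem logDefect_le_of_le (h : IsSaddle n r μ σ) {k : ℕ} (hk : 0 < k) (hkμ : k ≤ ⌊μ⌋₊) :
    logDefect n μ σ k ≤ logDefect n μ σ ⌊μ⌋₊ + ((⌊μ⌋₊ : ℝ) - k) * (1 / (2 * σ ^ 2)) := by
  have key : ∀ b, k ≤ b →
      logDefect n μ σ k ≤ logDefect n μ σ b + ((b : ℝ) - k) * (1 / (2 * σ ^ 2)) := by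
    intro b hb
    induction b, hb using Nat.le_induction with
    | base => simp
    | succ b hb ih =>
      have := h.neg_le_logDefect_succ_sub (j := b) (by omega)
      push_cast
      linarith
  exact key _ hkμ

/-- To the right of `μ` the weights decrease, and beyond `μ + σ` each step lowers the logarithm by
at least `1 / (2 σ)`. The summand `2` pays for the step across `μ`. -/
theorem log_dobinski_le_of_ge (h : IsSaddle n r μ σ) {k : ℕ} (hk : ⌊μ⌋₊ ≤ k) :
    Real.log (dobinski n k) ≤
      Real.log (dobinski n ⌊μ⌋₊) + 2 - max 0 ((k - μ - σ - 1) / (2 * σ)) := by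
  obtain ⟨hf1, hf2, hf3, hf4⟩ := h.floor_mu_bounds
  have hσ4 := h.four_le_sigma
  have hσ : 0 < σ := by linarith
  have hμ := h.mu_pos
  have hr := h.one_le_r
  have hneg : ∀ x : ℝ, x ≤ μ + σ + 1 → max 0 ((x - μ - σ - 1) / (2 * σ)) = 0 := by
    intro x hx
    exact max_eq_left (div_nonpos_of_nonpos_of_nonneg (by linarith) (by positivity))
  induction k, hk using Nat.le_induction with
  | base =>
    rw [hneg _ (by linarith)]
    linarith
  | succ j hj ih =>
    have hj0 : 0 < j := by omega
    have hj0' : (0 : ℝ) < j := by exact_mod_cast hj0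
    have hinc := h.log_dobinski_succ_le hj0
    have hmax0 : 0 ≤ max 0 (((j : ℝ) - μ - σ - 1) / (2 * σ)) := le_max_left _ _
    push_cast
    rcases hj.eq_or_lt with rfl | hlt
    · rw [hneg _ (by linarith)]
      have h1 : (r + 1) * (μ / (⌊μ⌋₊ : ℝ) - 1) ≤ 2 := by
        have h2 : μ / (⌊μ⌋₊ : ℝ) - 1 ≤ 2 / μ := by
          rw [div_sub_one hj0'.ne', div_le_div_iff₀ hj0' hμ]
          nlinarith
        calc (r + 1) * (μ / (⌊μ⌋₊ : ℝ) - 1) ≤ (r + 1) * (2 / μ) :=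
              mul_le_mul_of_nonneg_left h2 (by linarith)
          _ = 2 / σ ^ 2 := by rw [← h.div_mu]; ring
          _ ≤ 2 := by
            rw [div_le_iff₀ (by positivity)]
            nlinarith
      linarith
    · have hjμ : μ < j := by
        have : (⌊μ⌋₊ : ℝ) + 1 ≤ j := by exact_mod_cast hlt
        linarith
      rcases lt_or_ge ((j : ℝ) - μ) σ with hlt' | hge
      · rw [hneg _ (by linarith)]
        have h1 : (r + 1) * (μ / (j : ℝ) - 1) ≤ 0 := by
          refine mul_nonpos_of_nonneg_of_nonpos (by linarith) ?_
          rw [sub_nonpos, div_le_one hj0']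
          exact hjμ.le
        linarith
      · have h1 : (r + 1) * (μ / (j : ℝ) - 1) ≤ -(1 / (2 * σ)) := by
          rw [div_sub_one hj0'.ne', ← mul_div_assoc, ← neg_div, div_le_div_iff₀ hj0' (by positivity)]
          have h2 : (2 * σ * (r + 1) - 1) * σ ≤ (2 * σ * (r + 1) - 1) * (j - μ) :=
            mul_le_mul_of_nonneg_left hge (by nlinarith)
          have h3 : μ = σ ^ 2 * (r + 1) := h.mu_eq
          nlinarith
        have h2 : max 0 (((j : ℝ) + 1 - μ - σ - 1) / (2 * σ)) ≤
            max 0 (((j : ℝ) - μ - σ - 1) / (2 * σ)) + 1 / (2 * σ) := by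
          refine max_le (by positivity) ?_
          have : ((j : ℝ) + 1 - μ - σ - 1) / (2 * σ) =
            ((j : ℝ) - μ - σ - 1) / (2 * σ) + 1 / (2 * σ) := by ring
          rw [this]
          linarith [le_max_right 0 (((j : ℝ) - μ - σ - 1) / (2 * σ))]
        linarith

/-- Exponential decay of the Dobiński weights, valid for all `k`. -/
theorem dobinski_le_peak_mul (h : IsSaddle n r μ σ) (k : ℕ) :
    dobinski n k ≤ peak n μ σ * Real.exp (3 - |((k : ℝ) - μ) / σ| / 2) := by
  obtain ⟨hf1, hf2, hf3, hf4⟩ := h.floor_mu_bounds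
  have hσ4 := h.four_le_sigma
  have hσ : 0 < σ := by linarith
  rcases Nat.eq_zero_or_pos k with rfl | hk
  · have : dobinski n 0 = 0 := by
      simp [dobinski, h.n_pos.ne']
    rw [this]
    exact mul_nonneg (peak_pos n μ σ).le (Real.exp_pos _).le
  rw [peak, ← Real.exp_add, ← Real.log_le_iff_le_exp (dobinski_pos n hk)]
  rw [abs_div, abs_of_pos hσ]
  rcases le_total k ⌊μ⌋₊ with hle | hle
  · have h1 := h.logDefect_le_of_le hk hle
    have hkμ : (k : ℝ) ≤ ⌊μ⌋₊ := by exact_mod_cast hle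
    rw [abs_of_nonpos (by linarith)]
    have h2 : logDefect n μ σ k = Real.log (dobinski n k) + (-(k - μ) / σ) ^ 2 / 2 := by
      rw [logDefect, div_pow, div_div, neg_sq]
      ring
    set z := -((k : ℝ) - μ) / σ with hz
    have h3 : ((⌊μ⌋₊ : ℝ) - k) * (1 / (2 * σ ^ 2)) ≤ z / 2 := by
      have h4 : ((⌊μ⌋₊ : ℝ) - k) * (1 / (2 * σ ^ 2)) ≤ (μ - k) * (1 / (2 * σ)) := by
        gcongr <;> nlinarith
      have h5 : (μ - k) * (1 / (2 * σ)) = z / 2 := by rw [hz]; ring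
      linarith
    nlinarith [sq_nonneg (z - 1)]
  · have h1 := h.log_dobinski_le_of_ge hle
    have h2 : Real.log (dobinski n ⌊μ⌋₊) ≤ logDefect n μ σ ⌊μ⌋₊ := by
      rw [logDefect]
      have : 0 ≤ ((⌊μ⌋₊ : ℝ) - μ) ^ 2 / (2 * σ ^ 2) := by positivity
      linarith
    have hkμ : (⌊μ⌋₊ : ℝ) ≤ k := by exact_mod_cast hle
    have h3 := le_max_right 0 (((k : ℝ) - μ - σ - 1) / (2 * σ))
    have h4 : |(k : ℝ) - μ| ≤ (k - μ) + 2 := by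
      rw [abs_le]; constructor <;> linarith
    have h5 : |(k : ℝ) - μ| / σ / 2 ≤ ((k : ℝ) - μ - σ - 1) / (2 * σ) + 1 := by
      rw [div_div, div_add_one (by positivity), mul_comm σ 2]
      gcongr
      linarith
    linarith

end IsSaddle

/-! ### From the Dobiński weights to the number of blocks -/

namespace IsSaddle

variable {n : ℕ} {r μ σ : ℝ}

theorem dobinski_sub_le (h : IsSaddle n r μ σ) {k j : ℕ} (hj : j ≤ k) :
    dobinski n (k - j) ≤ dobinski n k * Real.exp (j * (|(k : ℝ) - μ| / σ ^ 2)) := by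
  have hσ : 0 < σ := by linarith [h.four_le_sigma]
  induction j with
  | zero => simp
  | succ j ih =>
    have h1 := ih (by omega)
    have h2 := h.dobinski_le_succ (k - (j + 1))
    have h3 : k - (j + 1) + 1 = k - j := by omega
    have h4 : ((k - (j + 1) : ℕ) : ℝ) + 1 ≤ k := by
      have : k - (j + 1) + 1 ≤ k := by omega
      exact_mod_cast this
    rw [h3] at h2
    calc dobinski n (k - (j + 1)) ≤ _ := h2
      _ ≤ dobinski n (k - j) * Real.exp (|(k : ℝ) - μ| / σ ^ 2) := by
        refine mul_le_mul_of_nonneg_left (Real.exp_le_exp.2 ?_) (dobinski_nonneg _ _)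
        gcongr
        linarith [le_abs_self ((k : ℝ) - μ)]
      _ ≤ (dobinski n k * Real.exp (j * (|(k : ℝ) - μ| / σ ^ 2))) *
          Real.exp (|(k : ℝ) - μ| / σ ^ 2) :=
        mul_le_mul_of_nonneg_right h1 (Real.exp_pos _).le
      _ = _ := by
        rw [mul_assoc, ← Real.exp_add]
        push_cast
        congr 2
        ring

/-- The linear lower bound holds for every `j ≤ k`, however large. -/
theorem le_dobinski_sub (h : IsSaddle n r μ σ) {k j : ℕ} (hj : j ≤ k) :
    dobinski n k * (1 - 2 * j * ((|(k : ℝ) - μ| + j) / σ ^ 2)) ≤ dobinski n (k - j) := by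
  have hσ : 0 < σ := by linarith [h.four_le_sigma]
  have hμ := h.mu_pos
  have hr := h.one_le_r
  set H := |(k : ℝ) - μ| with hH
  have hH0 : 0 ≤ H := abs_nonneg _
  rcases le_or_gt (μ / 2) (H + j) with hbig | hsmall
  · -- For `j` of the order of `μ` the left side is not positive.
    rcases Nat.eq_zero_or_pos j with rfl | hj0
    · simp
    · refine le_trans (mul_nonpos_of_nonneg_of_nonpos (dobinski_nonneg _ _) ?_)
        (dobinski_nonneg _ _)
      have hj1 : (1 : ℝ) ≤ j := by exact_mod_cast hj0
      have h1 : (1 : ℝ) / 2 ≤ (H + j) / σ ^ 2 := by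
        rw [div_le_div_iff₀ (by norm_num) (by positivity)]
        linarith [h.two_mul_sq_le_mu, sq_nonneg σ]
      nlinarith
  · set q := (H + j) / σ ^ 2 with hq
    have key : ∀ i : ℕ, i ≤ j → dobinski n k ≤ dobinski n (k - i) * Real.exp (i * (2 * q)) := by
      intro i hi
      induction i with
      | zero => simp
      | succ i ih =>
        have h1 := ih (by omega)
        have hm : μ / 2 ≤ ((k - (i + 1) : ℕ) : ℝ) := by
          have h2 : (k : ℝ) - j ≤ ((k - (i + 1) : ℕ) : ℝ) := by
            have : k - j ≤ k - (i + 1) := by omega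
            rw [← Nat.cast_sub hj]
            exact_mod_cast this
          linarith [neg_abs_le ((k : ℝ) - μ)]
        have hm0 : (0 : ℝ) < ((k - (i + 1) : ℕ) : ℝ) := by linarith
        have h3 := h.dobinski_succ_le (j := k - (i + 1)) (by exact_mod_cast hm0)
        rw [show k - (i + 1) + 1 = k - i by omega] at h3
        have h4 : (r + 1) * (μ / ((k - (i + 1) : ℕ) : ℝ) - 1) ≤ 2 * q := by
          have h5 : μ / ((k - (i + 1) : ℕ) : ℝ) - 1 ≤ (H + j) / (μ / 2) := by
            rw [div_sub_one hm0.ne']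
            have h2 : (k : ℝ) - j ≤ ((k - (i + 1) : ℕ) : ℝ) := by
              have : k - j ≤ k - (i + 1) := by omega
              rw [← Nat.cast_sub hj]
              exact_mod_cast this
            gcongr
            linarith [neg_abs_le ((k : ℝ) - μ)]
          calc (r + 1) * (μ / ((k - (i + 1) : ℕ) : ℝ) - 1) ≤ (r + 1) * ((H + j) / (μ / 2)) :=
                mul_le_mul_of_nonneg_left h5 (by linarith)
            _ = 2 * ((r + 1) * (H + j) / μ) := by field_simp
            _ = 2 * q := by rw [h.div_mu]
        calc dobinski n k ≤ _ := h1
          _ ≤ (dobinski n (k - (i + 1)) * Real.exp (2 * q)) * Real.exp (i * (2 * q)) := by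
            refine mul_le_mul_of_nonneg_right (h3.trans ?_) (Real.exp_pos _).le
            exact mul_le_mul_of_nonneg_left (Real.exp_le_exp.2 h4) (dobinski_nonneg _ _)
          _ = _ := by
            rw [mul_assoc, ← Real.exp_add]
            push_cast
            congr 2
            ring
    have h1 := key j le_rfl
    have h2 : 1 - 2 * j * q ≤ Real.exp (-(j * (2 * q))) := by
      linarith [Real.add_one_le_exp (-((j : ℝ) * (2 * q)))]
    calc dobinski n k * (1 - 2 * j * q) ≤ dobinski n k * Real.exp (-(j * (2 * q))) :=
          mul_le_mul_of_nonneg_left h2 (dobinski_nonneg _ _)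
      _ ≤ (dobinski n (k - j) * Real.exp (j * (2 * q))) * Real.exp (-(j * (2 * q))) :=
          mul_le_mul_of_nonneg_right h1 (Real.exp_pos _).le
      _ = dobinski n (k - j) := by
          rw [mul_assoc, ← Real.exp_add]
          simp

/-- Weights at bounded distance from `k` agree up to `O((1 + |y|) / σ)`. The factor `exp (2 j)` is
harmless because of the factor `1 / j!` in `blockCount_eq_sum`; for `j > k` the statement
is that this factor is already large. -/
theorem abs_shift_sub_le (h : IsSaddle n r μ σ) {k : ℕ} (hk : |(k : ℝ) - μ| ≤ σ ^ 2) (j : ℕ) :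
    |(if j ≤ k then dobinski n (k - j) else 0) - dobinski n k| ≤
      dobinski n k * (2 * ((1 + |((k : ℝ) - μ) / σ|) / σ)) * Real.exp 2 ^ j := by
  have hσ4 := h.four_le_sigma
  have hσ : 0 < σ := by linarith
  set H := |(k : ℝ) - μ| with hH
  have hH0 : 0 ≤ H := abs_nonneg _
  have hd := dobinski_nonneg n k
  set η := H / σ ^ 2 with hη
  have hη0 : 0 ≤ η := by positivity
  have hη1 : η ≤ 1 := div_le_one_of_le₀ hk (by positivity)
  have hy : |((k : ℝ) - μ) / σ| = H / σ := by rw [abs_div, abs_of_pos hσ]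
  have hδ : η + 1 / σ ^ 2 ≤ (1 + |((k : ℝ) - μ) / σ|) / σ := by
    rw [hy]
    have h1 : (1 : ℝ) / σ ^ 2 ≤ 1 / σ := by
      apply one_div_le_one_div_of_le hσ
      nlinarith
    have h2 : η = H / σ / σ := by rw [hη]; field_simp
    rw [h2, add_div]
    linarith
  have hj1 : (j : ℝ) ≤ Real.exp j := by linarith [Real.add_one_le_exp (j : ℝ)]
  have hexp : Real.exp 2 ^ j = Real.exp j * Real.exp j := by
    rw [← Real.exp_nat_mul, ← Real.exp_add]
    congr 1
    ring
  have he1 : 1 ≤ Real.exp (j : ℝ) := Real.one_le_exp (by positivity)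
  have hj2 : (j : ℝ) * j ≤ Real.exp 2 ^ j := by
    rw [hexp]
    exact mul_le_mul hj1 hj1 (by positivity) (by positivity)
  have hj3 : (j : ℝ) ≤ Real.exp 2 ^ j := by
    rw [hexp]
    nlinarith
  have hq : (H + j) / σ ^ 2 = η + j * (1 / σ ^ 2) := by rw [hη]; ring
  have hs : 0 ≤ 1 / σ ^ 2 := by positivity
  -- the lower bound, common to both cases
  have hlow : 2 * j * ((H + j) / σ ^ 2) ≤
      2 * ((1 + |((k : ℝ) - μ) / σ|) / σ) * Real.exp 2 ^ j := by
    calc 2 * j * ((H + j) / σ ^ 2) = 2 * (j * η + j * j * (1 / σ ^ 2)) := by rw [hq]; ring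
      _ ≤ 2 * (Real.exp 2 ^ j * η + Real.exp 2 ^ j * (1 / σ ^ 2)) := by gcongr
      _ = 2 * (η + 1 / σ ^ 2) * Real.exp 2 ^ j := by ring
      _ ≤ _ := by gcongr
  rw [mul_assoc]
  split_ifs with hjk
  · have h1 := h.dobinski_sub_le hjk
    have h2 := h.le_dobinski_sub hjk
    have h3 : Real.exp (j * η) - 1 ≤ 2 * ((1 + |((k : ℝ) - μ) / σ|) / σ) * Real.exp 2 ^ j := by
      have h4 : Real.exp (j * η) - 1 ≤ (j * η) * Real.exp (j * η) := by
        have h5 := Real.add_one_le_exp (-(j * η))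
        have h6 : Real.exp (-(j * η)) * Real.exp (j * η) = 1 := by rw [← Real.exp_add]; simp
        nlinarith [Real.exp_pos (j * η)]
      calc Real.exp (j * η) - 1 ≤ (j * η) * Real.exp (j * η) := h4
        _ ≤ (Real.exp j * η) * Real.exp j := by
          have : (j : ℝ) * η ≤ j := by nlinarith [Nat.cast_nonneg (α := ℝ) j]
          gcongr
        _ = η * Real.exp 2 ^ j := by rw [hexp]; ring
        _ ≤ 2 * ((1 + |((k : ℝ) - μ) / σ|) / σ) * Real.exp 2 ^ j := by
          gcongr
          linarith
    rw [abs_le]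
    constructor
    · nlinarith
    · nlinarith
  · rw [zero_sub, abs_neg, abs_of_nonneg hd]
    have hkj : (k : ℝ) + 1 ≤ j := by exact_mod_cast not_le.1 hjk
    have hj1' : (1 : ℝ) ≤ j := by linarith [Nat.cast_nonneg (α := ℝ) k]
    have h1 : 1 ≤ 2 * j * ((H + j) / σ ^ 2) := by
      have h2 : 1 ≤ (H + j) / σ ^ 2 := by
        rw [one_le_div (by positivity)]
        linarith [h.two_mul_sq_le_mu, neg_abs_le ((k : ℝ) - μ), sq_nonneg σ]
      nlinarith
    nlinarith [h1.trans hlow]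

/-- Near the maximum, the number of partitions with `k` blocks is `exp (-1)` times the Dobiński
weight, up to a relative error `O((1 + |y|) / σ)`. -/
theorem abs_exp_mul_blockCount_sub_le (h : IsSaddle n r μ σ) {k : ℕ}
    (hk : |(k : ℝ) - μ| ≤ σ ^ 2) :
    |Real.exp 1 * blockCount n k - dobinski n k| ≤
      2 * Real.exp (1 + Real.exp 2) * ((1 + |((k : ℝ) - μ) / σ|) / σ) * dobinski n k := by
  set δ := (1 + |((k : ℝ) - μ) / σ|) / σ with hδ
  have hexpsum : ∀ x : ℝ, HasSum (fun j : ℕ => x ^ j / (j.factorial : ℝ)) (Real.exp x) := by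
    intro x
    rw [Real.exp_eq_exp_ℝ]
    exact NormedSpace.expSeries_div_hasSum_exp x
  have hS : HasSum (fun j : ℕ => (-1 : ℝ) ^ j / (j.factorial : ℝ) *
      (if j ≤ k then dobinski n (k - j) else 0)) (blockCount n k) := by
    rw [blockCount_eq_sum]
    have h1 : ∑ j ∈ Finset.range (k + 1), (-1 : ℝ) ^ j / (j.factorial : ℝ) * dobinski n (k - j) =
        ∑ j ∈ Finset.range (k + 1), (-1 : ℝ) ^ j / (j.factorial : ℝ) *
          (if j ≤ k then dobinski n (k - j) else 0) := by
      refine Finset.sum_congr rfl fun j hj => ?_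
      rw [if_pos (Nat.lt_succ_iff.1 (Finset.mem_range.1 hj))]
    rw [h1]
    refine hasSum_sum_of_ne_finset_zero fun j hj => ?_
    rw [if_neg (fun hjk => hj (Finset.mem_range.2 (Nat.lt_succ_of_le hjk))), mul_zero]
  have hD := hS.sub ((hexpsum (-1)).mul_right (dobinski n k))
  have hB := (hexpsum (Real.exp 2)).mul_left (dobinski n k * (2 * δ))
  have hle : ∀ j : ℕ, ‖(-1 : ℝ) ^ j / (j.factorial : ℝ) *
      (if j ≤ k then dobinski n (k - j) else 0) -
      (-1 : ℝ) ^ j / (j.factorial : ℝ) * dobinski n k‖ ≤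
      dobinski n k * (2 * δ) * (Real.exp 2 ^ j / (j.factorial : ℝ)) := by
    intro j
    rw [← mul_sub, norm_mul, norm_div, norm_pow, norm_neg, norm_one, one_pow, Real.norm_natCast,
      Real.norm_eq_abs]
    have := h.abs_shift_sub_le hk j
    calc 1 / (j.factorial : ℝ) * |(if j ≤ k then dobinski n (k - j) else 0) - dobinski n k| ≤
          1 / (j.factorial : ℝ) * (dobinski n k * (2 * δ) * Real.exp 2 ^ j) := by gcongr
      _ = _ := by ring
  have hb := tsum_of_norm_bounded hB hle
  rw [hD.tsum_eq, Real.norm_eq_abs] at hb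
  have h2 : Real.exp 1 * blockCount n k - dobinski n k =
      Real.exp 1 * (blockCount n k - Real.exp (-1) * dobinski n k) := by
    rw [mul_sub, ← mul_assoc, ← Real.exp_add]
    simp
  rw [h2, abs_mul, abs_of_pos (Real.exp_pos 1), Real.exp_add]
  calc Real.exp 1 * _ ≤ Real.exp 1 * (dobinski n k * (2 * δ) * Real.exp (Real.exp 2)) := by gcongr
    _ = _ := by ring

end IsSaddle

/-- The number of partitions with `k` blocks, scaled so as to be close to the Gaussian profile, and
extended by zero to negative `k`. -/
noncomputable def scaledCount (n : ℕ) (μ σ : ℝ) (k : ℤ) : ℝ :=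
  if 0 ≤ k then Real.exp 1 * blockCount n k.toNat / peak n μ σ else 0

theorem scaledCount_natCast (n : ℕ) (μ σ : ℝ) (k : ℕ) :
    scaledCount n μ σ k = Real.exp 1 * blockCount n k / peak n μ σ := by
  simp [scaledCount]

theorem scaledCount_nonneg (n : ℕ) (μ σ : ℝ) (k : ℤ) : 0 ≤ scaledCount n μ σ k := by
  unfold scaledCount
  have := (peak_pos n μ σ).le
  split_ifs <;> positivity

theorem abs_exp_sub_one_le_mul_exp_abs (x : ℝ) : |Real.exp x - 1| ≤ |x| * Real.exp |x| := by
  have key : ∀ t : ℝ, 0 ≤ t → Real.exp t - 1 ≤ t * Real.exp t := by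
    intro t _
    have h5 := Real.add_one_le_exp (-t)
    have h6 : Real.exp (-t) * Real.exp t = 1 := by rw [← Real.exp_add]; simp
    nlinarith [Real.exp_pos t]
  rcases le_total 0 x with hx | hx
  · rw [abs_of_nonneg hx, abs_of_nonneg (by linarith [Real.one_le_exp hx])]
    exact key x hx
  · rw [abs_of_nonpos hx, abs_of_nonpos (by linarith [Real.exp_le_one_iff.2 hx])]
    have h1 := Real.add_one_le_exp x
    have h2 := Real.one_le_exp (neg_nonneg.2 hx)
    nlinarith

/-- The absolute constant in the local comparison of `scaledCount` with the Gaussian profile. -/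
noncomputable def localConst : ℝ := Real.exp 55 * (5 + 4 * Real.exp (1 + Real.exp 2))

theorem localConst_pos : 0 < localConst := by unfold localConst; positivity

namespace IsSaddle

variable {n : ℕ} {r μ σ : ℝ}

/-- Local comparison: in the range `|y|³ ≤ 10 σ` the scaled number of partitions with `k` blocks is
Gaussian with relative error `O((1 + |y|³) / σ)`. -/
theorem abs_scaledCount_sub_le (h : IsSaddle n r μ σ) {k : ℤ}
    (hk : |((k : ℝ) - μ) / σ| ^ 3 ≤ 10 * σ) :
    |scaledCount n μ σ k - gaussProfile μ σ k| ≤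
      localConst * ((1 + |((k : ℝ) - μ) / σ| ^ 3) / σ) * gaussProfile μ σ k := by
  have hσ4 := h.four_le_sigma
  have hσ : 0 < σ := by linarith
  have hH : |(k : ℝ) - μ| ≤ σ ^ 2 := by
    have h1 : |((k : ℝ) - μ) / σ| ≤ σ := by
      refine le_of_pow_le_pow_left₀ three_ne_zero hσ.le (hk.trans ?_)
      nlinarith [mul_nonneg hσ.le (by nlinarith : 0 ≤ σ ^ 2 - 10)]
    rw [abs_div, abs_of_pos hσ, div_le_iff₀ hσ] at h1
    linarith
  have hkμ : μ / 2 ≤ (k : ℝ) := by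
    linarith [h.two_mul_sq_le_mu, neg_abs_le ((k : ℝ) - μ)]
  have hk0 : (0 : ℝ) < k := by linarith [h.mu_pos]
  have hk0' : 0 < k := by exact_mod_cast hk0
  lift k to ℕ using hk0'.le
  rw [Int.cast_natCast] at *
  have hk0n : 0 < k := by exact_mod_cast hk0'
  set z := |((k : ℝ) - μ) / σ| with hz
  have hz0 : 0 ≤ z := abs_nonneg _
  have hE := h.abs_logDefect_sub_le_cube hkμ
  have hS := h.abs_exp_mul_blockCount_sub_le hH
  rw [dobinski_eq_peak_mul n μ hσ hk0n] at hS
  rw [← hz] at hE hS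
  set E := logDefect n μ σ k - logDefect n μ σ ⌊μ⌋₊ with hEdef
  set A := peak n μ σ with hA
  have hA0 : 0 < A := peak_pos n μ σ
  set G := gaussProfile μ σ k with hG
  have hG0 : 0 < G := Real.exp_pos _
  set τ := (1 + z ^ 3) / σ with hτ
  have hτ0 : 0 ≤ τ := by positivity
  have hτ11 : τ ≤ 11 := by
    rw [hτ, div_le_iff₀ hσ]
    linarith
  have hE55 : |E| ≤ 55 := hE.trans (by linarith)
  have h1τ : (1 + z) / σ ≤ 2 * τ := by
    rw [hτ, ← mul_div_assoc]
    gcongr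
    nlinarith [sq_nonneg (z - 1), mul_nonneg hz0 (sq_nonneg (z - 1))]
  have hexpE : Real.exp E ≤ Real.exp 55 := Real.exp_le_exp.2 ((le_abs_self E).trans hE55)
  have h1 : |Real.exp E - 1| ≤ 5 * τ * Real.exp 55 :=
    (abs_exp_sub_one_le_mul_exp_abs E).trans
      (mul_le_mul hE (Real.exp_le_exp.2 hE55) (Real.exp_pos _).le (by positivity))
  rw [scaledCount_natCast]
  have h2 : |Real.exp 1 * (blockCount n k : ℝ) / A - Real.exp E * G| ≤
      4 * Real.exp (1 + Real.exp 2) * τ * (Real.exp 55 * G) := by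
    have h3 : Real.exp 1 * (blockCount n k : ℝ) / A - Real.exp E * G =
        (Real.exp 1 * (blockCount n k : ℝ) - A * Real.exp E * G) / A := by field_simp
    rw [h3, abs_div, abs_of_pos hA0, div_le_iff₀ hA0]
    refine hS.trans ?_
    calc 2 * Real.exp (1 + Real.exp 2) * ((1 + z) / σ) * (A * Real.exp E * G) ≤
          2 * Real.exp (1 + Real.exp 2) * (2 * τ) * (A * Real.exp 55 * G) := by gcongr
      _ = _ := by ring
  have h4 : |Real.exp E * G - G| ≤ 5 * τ * Real.exp 55 * G := by
    rw [show Real.exp E * G - G = (Real.exp E - 1) * G by ring, abs_mul, abs_of_pos hG0]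
    gcongr
  calc |Real.exp 1 * (blockCount n k : ℝ) / A - G| ≤ _ := abs_sub_le _ (Real.exp E * G) _
    _ ≤ 4 * Real.exp (1 + Real.exp 2) * τ * (Real.exp 55 * G) + 5 * τ * Real.exp 55 * G :=
        add_le_add h2 h4
    _ = localConst * τ * G := by unfold localConst; ring

theorem scaledCount_le (h : IsSaddle n r μ σ) (k : ℤ) :
    scaledCount n μ σ k ≤ Real.exp (4 - |((k : ℝ) - μ) / σ| / 2) := by
  rcases lt_or_ge k 0 with hk | hk
  · rw [scaledCount, if_neg (not_le.2 hk)]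
    exact (Real.exp_pos _).le
  · lift k to ℕ using hk
    rw [scaledCount_natCast, div_le_iff₀ (peak_pos n μ σ), Int.cast_natCast]
    have h1 := (blockCount_le_dobinski n k).trans (h.dobinski_le_peak_mul k)
    calc Real.exp 1 * (blockCount n k : ℝ) ≤
          Real.exp 1 * (peak n μ σ * Real.exp (3 - |((k : ℝ) - μ) / σ| / 2)) := by gcongr
      _ = Real.exp 1 * Real.exp (3 - |((k : ℝ) - μ) / σ| / 2) * peak n μ σ := by ring
      _ = _ := by
        rw [← Real.exp_add]
        congr 2
        ring

end IsSaddle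

theorem gaussProfile_le_exp (μ σ s : ℝ) :
    gaussProfile μ σ s ≤ Real.exp (4 - |(s - μ) / σ| / 2) := by
  refine Real.exp_le_exp.2 ?_
  rw [← sq_abs]
  nlinarith [sq_nonneg (|(s - μ) / σ| - 1)]

theorem one_add_cube_mul_exp_le {t : ℝ} (ht : 0 ≤ t) :
    (1 + t ^ 3) * Real.exp (4 - t / 2) ≤ 3840 * Real.exp 5 * (1 + t ^ 2)⁻¹ := by
  have h1 := Real.pow_div_factorial_le_exp ((1 + t) / 2) (by positivity) 5
  have h2 : (1 + t ^ 3) * (1 + t ^ 2) ≤ (1 + t) ^ 5 := by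
    have h3 : 1 + t ^ 3 ≤ (1 + t) ^ 3 := by nlinarith [pow_nonneg ht 2]
    have h4 : 1 + t ^ 2 ≤ (1 + t) ^ 2 := by nlinarith
    calc (1 + t ^ 3) * (1 + t ^ 2) ≤ (1 + t) ^ 3 * (1 + t) ^ 2 := by gcongr
      _ = _ := by ring
  have h5 : (1 + t) ^ 5 ≤ 3840 * Real.exp ((1 + t) / 2) := by
    have : (Nat.factorial 5 : ℝ) = 120 := by norm_num [Nat.factorial]
    rw [this, div_pow, div_div, div_le_iff₀ (by norm_num)] at h1
    linarith
  rw [← div_eq_mul_inv, le_div_iff₀ (by positivity)]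
  calc (1 + t ^ 3) * Real.exp (4 - t / 2) * (1 + t ^ 2) =
        ((1 + t ^ 3) * (1 + t ^ 2)) * Real.exp (4 - t / 2) := by ring
    _ ≤ (3840 * Real.exp ((1 + t) / 2)) * Real.exp (4 - t / 2) :=
        mul_le_mul_of_nonneg_right (h2.trans h5) (Real.exp_pos _).le
    _ = 3840 * Real.exp (4 + 1 / 2) := by
        rw [mul_assoc, ← Real.exp_add]
        congr 2
        ring
    _ ≤ 3840 * Real.exp 5 := by
        gcongr
        norm_num

/-- The absolute constant in the global comparison of `scaledCount` with the Gaussian profile. -/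
noncomputable def globalConst : ℝ := (localConst + 1) * (3840 * Real.exp 5)

theorem globalConst_pos : 0 < globalConst := by
  have := localConst_pos
  unfold globalConst; positivity

/-- Global comparison. Outside the range of the local comparison both quantities are exponentially
small in `|y|`, and `1 ≤ |y|³ / σ` there. -/
theorem IsSaddle.abs_scaledCount_sub_le_cauchyProfile {n : ℕ} {r μ σ : ℝ}
    (h : IsSaddle n r μ σ) (k : ℤ) :
    |scaledCount n μ σ k - gaussProfile μ σ k| ≤ globalConst / σ * cauchyProfile μ σ k := by
  have hσ : 0 < σ := by linarith [h.four_le_sigma]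
  set z := |((k : ℝ) - μ) / σ| with hz
  have hz0 : 0 ≤ z := abs_nonneg _
  have hlc := localConst_pos
  have hG := gaussProfile_le_exp μ σ k
  have hpoly := one_add_cube_mul_exp_le hz0
  have hcp : cauchyProfile μ σ k = (1 + z ^ 2)⁻¹ := by rw [cauchyProfile, hz, sq_abs]
  rw [← hz] at hG
  have key : |scaledCount n μ σ k - gaussProfile μ σ k| ≤
      (localConst + 1) / σ * ((1 + z ^ 3) * Real.exp (4 - z / 2)) := by
    rcases le_or_gt (z ^ 3) (10 * σ) with hle | hgt
    · calc |scaledCount n μ σ k - gaussProfile μ σ k| ≤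
            localConst * ((1 + z ^ 3) / σ) * gaussProfile μ σ k := h.abs_scaledCount_sub_le hle
        _ ≤ (localConst + 1) * ((1 + z ^ 3) / σ) * Real.exp (4 - z / 2) := by
          gcongr
          · exact (Real.exp_pos _).le
          · linarith
        _ = _ := by ring
    · have h1 : |scaledCount n μ σ k - gaussProfile μ σ k| ≤ Real.exp (4 - z / 2) := by
        have h2 := h.scaledCount_le k
        have h3 := scaledCount_nonneg n μ σ k
        have h4 : 0 < gaussProfile μ σ k := Real.exp_pos _
        rw [abs_le]
        constructor <;> linarith
      have h5 : 1 ≤ (localConst + 1) / σ * (1 + z ^ 3) := by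
        rw [div_mul_eq_mul_div, one_le_div hσ]
        nlinarith [pow_nonneg hz0 3]
      calc |scaledCount n μ σ k - gaussProfile μ σ k| ≤ 1 * Real.exp (4 - z / 2) := by rwa [one_mul]
        _ ≤ ((localConst + 1) / σ * (1 + z ^ 3)) * Real.exp (4 - z / 2) := by gcongr
        _ = _ := by ring
  refine key.trans ?_
  rw [hcp]
  calc (localConst + 1) / σ * ((1 + z ^ 3) * Real.exp (4 - z / 2)) ≤
        (localConst + 1) / σ * (3840 * Real.exp 5 * (1 + z ^ 2)⁻¹) := by gcongr
    _ = _ := by unfold globalConst; ring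

/-! ### Normalization and the limit theorems -/

theorem tsum_scaledCount (n : ℕ) (μ σ : ℝ) (P : ℤ → Prop) [DecidablePred P] :
    (∑' k : ℤ, if P k then scaledCount n μ σ k else 0) =
      Real.exp 1 / peak n μ σ *
        ∑ k ∈ (Finset.range (n + 1)).filter (fun k : ℕ => P k), (blockCount n k : ℝ) := by
  have hsupp : Function.support (fun k : ℤ => if P k then scaledCount n μ σ k else 0) ⊆
      Set.range ((↑) : ℕ → ℤ) := by
    intro k hk
    rcases lt_or_ge k 0 with h | h
    · exact absurd (by simp [scaledCount, not_le.2 h]) hk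
    · exact ⟨k.toNat, Int.toNat_of_nonneg h⟩
  rw [← Function.Injective.tsum_eq Nat.cast_injective hsupp,
    tsum_eq_sum (s := Finset.range (n + 1)), Finset.sum_filter, Finset.mul_sum]
  · refine Finset.sum_congr rfl fun k _ => ?_
    split_ifs
    · rw [scaledCount_natCast]
      ring
    · rw [mul_zero]
  · intro k hk
    have hk' : n < k := by
      rw [Finset.mem_range] at hk
      omega
    simp [scaledCount_natCast, blockCount_eq_zero_of_lt hk']

theorem sum_blockCount_pos (n : ℕ) : 0 < ∑ k ∈ Finset.range (n + 1), (blockCount n k : ℝ) := by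
  have h : 0 < Fintype.card (SetPartition n) := Fintype.card_pos
  rw [← sum_blockCount] at h
  exact_mod_cast h

theorem tsum_scaledCount_pos (n : ℕ) (μ σ : ℝ) : 0 < ∑' k : ℤ, scaledCount n μ σ k := by
  have h := tsum_scaledCount n μ σ (fun _ => True)
  simp only [if_true, Finset.filter_true] at h
  rw [h]
  exact mul_pos (div_pos (Real.exp_pos 1) (peak_pos n μ σ)) (sum_blockCount_pos n)

/-- The law of the number of blocks in terms of the scaled counts. -/
theorem uniformSetPartition_real_eq (n : ℕ) (μ σ : ℝ) (P : ℤ → Prop) [DecidablePred P] :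
    (uniformSetPartition n).real {π | P (numBlocks n π)} =
      (∑' k : ℤ, if P k then scaledCount n μ σ k else 0) / ∑' k : ℤ, scaledCount n μ σ k := by
  have h := tsum_scaledCount n μ σ (fun _ => True)
  simp only [if_true, Finset.filter_true] at h
  have hc : Real.exp 1 / peak n μ σ ≠ 0 := (div_pos (Real.exp_pos 1) (peak_pos n μ σ)).ne'
  rw [h, tsum_scaledCount, mul_div_mul_left _ _ hc]
  have h2 := uniformSetPartition_real_preimage n (fun k : ℕ => P k)
  rw [h2]
  congr

theorem one_le_sqrt_two_pi : 1 ≤ √(2 * Real.pi) := by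
  rw [Real.one_le_sqrt]
  linarith [Real.pi_gt_three]

/-- The absolute constant bounding the error in the normalizing sum. -/
noncomputable def normConst : ℝ := (2 * globalConst + 8) * Real.pi

theorem normConst_pos : 0 < normConst := by
  have := globalConst_pos
  have := Real.pi_pos
  unfold normConst; positivity

/-- The absolute constant in the local limit theorem. -/
noncomputable def localLimitConst : ℝ :=
  2 * Real.exp 4 * (1 + 10 * localConst) * (1 + 4 * normConst) +
    2 * normConst * (1 + 10 * localConst) + 5 * localConst

namespace IsSaddle

variable {n : ℕ} {r μ σ : ℝ}

/-- The central limit theorem with an explicit rate. -/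
theorem abs_cdf_sub_le (h : IsSaddle n r μ σ) (x : ℝ) :
    |(uniformSetPartition n).real {π | ((numBlocks n π : ℝ) - μ) / σ ≤ x} - stdNormalPhi x| ≤
      (2 * normConst + 1) / σ := by
  classical
  have hσ4 := h.four_le_sigma
  have hσ : 0 < σ := by linarith
  have hset : {π | ((numBlocks n π : ℝ) - μ) / σ ≤ x} =
      {π | (fun k : ℤ => (k : ℝ) ≤ μ + x * σ) (numBlocks n π)} := by
    ext π
    change ((numBlocks n π : ℝ) - μ) / σ ≤ x ↔ (((numBlocks n π : ℕ) : ℤ) : ℝ) ≤ μ + x * σ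
    rw [Int.cast_natCast, div_le_iff₀ hσ]
    exact sub_le_iff_le_add'
  have hp1 : (uniformSetPartition n).real {π | ((numBlocks n π : ℝ) - μ) / σ ≤ x} ≤ 1 := by
    have : IsProbabilityMeasure (uniformSetPartition n) := by
      unfold uniformSetPartition; infer_instance
    exact measureReal_le_one
  have hp0 : 0 ≤ (uniformSetPartition n).real {π | ((numBlocks n π : ℝ) - μ) / σ ≤ x} :=
    measureReal_nonneg
  have hprob := uniformSetPartition_real_eq n μ σ (fun k : ℤ => (k : ℝ) ≤ μ + x * σ)
  rw [← hset] at hprob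
  rw [hprob] at hp0 hp1 ⊢
  have hN := abs_tsum_le_sub_setIntegral_le (by linarith) globalConst_pos.le
    h.abs_scaledCount_sub_le_cauchyProfile (μ + x * σ)
  have hV := abs_tsum_sub_sigma_le (by linarith) globalConst_pos.le
    h.abs_scaledCount_sub_le_cauchyProfile
  rw [setIntegral_gaussProfile μ hσ] at hN
  have hV0 := tsum_scaledCount_pos n μ σ
  set V := ∑' k : ℤ, scaledCount n μ σ k
  set N := ∑' k : ℤ, if (k : ℝ) ≤ μ + x * σ then scaledCount n μ σ k else 0
  set c := √(2 * Real.pi) with hc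
  have hc1 : 1 ≤ c := one_le_sqrt_two_pi
  change |N - _| ≤ normConst + 1 at hN
  change |V - _| ≤ normConst at hV
  change |N / V - _| ≤ _
  change N / V ≤ 1 at hp1
  change 0 ≤ N / V at hp0
  unfold stdNormalPhi
  rw [← hc]
  set J := ∫ t in Set.Iic x, Real.exp (-t ^ 2 / 2)
  have hid : N / V - 1 / c * J = ((N - σ * J) + N / V * (σ * c - V)) / (σ * c) := by
    field_simp
    ring
  have hcσ : σ ≤ σ * c := by nlinarith
  rw [hid, abs_div, abs_of_pos (by positivity : 0 < σ * c)]
  -- `N / V ≤ 1` makes a lower bound for `V` unnecessary.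
  have hnum : |(N - σ * J) + N / V * (σ * c - V)| ≤ 2 * normConst + 1 := by
    refine (abs_add_le _ _).trans ?_
    rw [abs_mul, abs_of_nonneg hp0, abs_sub_comm (σ * c)]
    have : N / V * |V - σ * c| ≤ 1 * normConst :=
      mul_le_mul hp1 hV (abs_nonneg _) zero_le_one
    linarith
  have hn0 := normConst_pos
  exact div_le_div₀ (by positivity) hnum hσ hcσ

/-- The local limit theorem, in the whole range `|x|³ ≤ σ`. -/
theorem exists_local_limit (h : IsSaddle n r μ σ) (hσK : 2 * normConst ≤ σ) {x : ℝ}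
    (hx : |x| ^ 3 ≤ σ) :
    ∃ ρ : ℝ, |ρ| ≤ localLimitConst * ((1 + |x| ^ 3) / σ) ∧
      (uniformSetPartition n).real {π | (numBlocks n π : ℤ) = ⌊μ + x * σ⌋} =
        Real.exp (-x ^ 2 / 2) / (√(2 * Real.pi) * σ) * (1 + ρ) := by
  classical
  have hσ4 := h.four_le_sigma
  have hσ : 0 < σ := by linarith
  have hnc := normConst_pos
  have hlc := localConst_pos
  have hfl := Int.floor_le (μ + x * σ)
  have hfl' := Int.lt_floor_add_one (μ + x * σ)
  set k := ⌊μ + x * σ⌋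
  set y := ((k : ℝ) - μ) / σ with hy
  have hyx : |x - y| ≤ 1 / σ := by
    have : x - y = (μ + x * σ - k) / σ := by rw [hy]; field_simp; ring
    rw [this, abs_div, abs_of_pos hσ, abs_of_nonneg (by linarith)]
    gcongr
    linarith
  have hσ1 : 1 / σ ≤ 1 := by rw [div_le_one hσ]; linarith
  have hx0 := abs_nonneg x
  have hy0 := abs_nonneg y
  have hyx' : |y| ≤ |x| + 1 := by
    have := abs_sub_abs_le_abs_sub y x
    rw [abs_sub_comm] at this
    linarith
  have hy3 : |y| ^ 3 ≤ 4 * |x| ^ 3 + 4 := by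
    calc |y| ^ 3 ≤ (|x| + 1) ^ 3 := by gcongr
      _ ≤ 4 * |x| ^ 3 + 4 := by
        nlinarith [mul_nonneg (add_nonneg hx0 zero_le_one) (sq_nonneg (|x| - 1))]
  set τ := (1 + |x| ^ 3) / σ with hτ
  have hτ0 : 0 ≤ τ := by positivity
  have hτ2 : τ ≤ 2 := by
    rw [hτ, div_le_iff₀ hσ]
    linarith
  have hστ : 1 / σ ≤ τ := by
    rw [hτ]
    gcongr
    linarith [pow_nonneg hx0 3]
  -- the law at `k`, and the two estimates it is made of
  have hprob : (uniformSetPartition n).real {π | (numBlocks n π : ℤ) = k} =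
      scaledCount n μ σ k / ∑' j : ℤ, scaledCount n μ σ j := by
    rw [uniformSetPartition_real_eq n μ σ (fun j => j = k), tsum_ite_eq]
  have hloc := h.abs_scaledCount_sub_le (k := k) (by rw [← hy]; linarith)
  have hV := abs_tsum_sub_sigma_le (by linarith) globalConst_pos.le
    h.abs_scaledCount_sub_le_cauchyProfile
  rw [hprob]
  have hV0 := tsum_scaledCount_pos n μ σ
  set V := ∑' j : ℤ, scaledCount n μ σ j
  change |V - _| ≤ normConst at hV
  set c := √(2 * Real.pi) with hc
  have hc1 : 1 ≤ c := one_le_sqrt_two_pi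
  have hcσ : σ ≤ c * σ := by nlinarith
  set G := gaussProfile μ σ k with hG
  have hG0 : 0 < G := Real.exp_pos _
  set v := scaledCount n μ σ k
  rw [← hy] at hloc
  set r₁ := v / G - 1 with hr₁
  have hr₁b : |r₁| ≤ 5 * localConst * τ := by
    have h1 : r₁ = (v - G) / G := by rw [hr₁]; field_simp
    rw [h1, abs_div, abs_of_pos hG0, div_le_iff₀ hG0]
    refine hloc.trans (mul_le_mul_of_nonneg_right ?_ hG0.le)
    have h2 : (1 + |y| ^ 3) / σ ≤ 5 * τ := by
      rw [hτ, ← mul_div_assoc]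
      gcongr
      linarith [pow_nonneg hx0 3]
    calc localConst * ((1 + |y| ^ 3) / σ) ≤ localConst * (5 * τ) := by gcongr
      _ = _ := by ring
  -- rounding `μ + x σ` down to `k` changes the Gaussian factor by `exp d`
  set d := (x ^ 2 - y ^ 2) / 2 with hd
  have hdb : |d| ≤ 2 * τ := by
    have h1 : d = (x - y) * ((x + y) / 2) := by rw [hd]; ring
    rw [h1, abs_mul]
    have h2 : |(x + y) / 2| ≤ |x| + 1 := by
      rw [abs_div, abs_two]
      linarith [abs_add_le x y]
    calc |x - y| * |(x + y) / 2| ≤ 1 / σ * (|x| + 1) := by gcongr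
      _ = (|x| + 1) / σ := by ring
      _ ≤ (2 * (1 + |x| ^ 3)) / σ := by
        gcongr
        nlinarith [mul_nonneg (add_nonneg hx0 zero_le_one) (sq_nonneg (|x| - 1)), sq_nonneg (|x| - 1)]
      _ = 2 * τ := by rw [hτ]; ring
  have hdexp : |Real.exp d - 1| ≤ 2 * Real.exp 4 * τ := by
    calc |Real.exp d - 1| ≤ |d| * Real.exp |d| := abs_exp_sub_one_le_mul_exp_abs d
      _ ≤ (2 * τ) * Real.exp 4 := by
        gcongr
        linarith
      _ = _ := by ring
  have hVlow : σ / 2 ≤ V := by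
    have := (abs_le.1 hV).1
    nlinarith
  set r₃ := c * σ / V - 1 with hr₃
  have hr₃b : |r₃| ≤ 2 * normConst * τ := by
    have h1 : r₃ = -(V - σ * c) / V := by rw [hr₃]; field_simp; ring
    rw [h1, abs_div, abs_neg, abs_of_pos hV0]
    calc |V - σ * c| / V ≤ normConst / (σ / 2) := by gcongr
      _ = 2 * normConst * (1 / σ) := by field_simp
      _ ≤ 2 * normConst * τ := by gcongr
  have hGd : G = Real.exp (-x ^ 2 / 2) * Real.exp d := by
    rw [hG, gaussProfile, ← hy, ← Real.exp_add, hd]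
    congr 1
    ring
  refine ⟨Real.exp d * (1 + r₁) * (1 + r₃) - 1, ?_, ?_⟩
  · have h1 : |1 + r₁| ≤ 1 + 10 * localConst := by
      refine (abs_add_le _ _).trans ?_
      have := mul_le_mul_of_nonneg_left hτ2 (by positivity : 0 ≤ 5 * localConst)
      rw [abs_one]
      linarith
    have h3 : |1 + r₃| ≤ 1 + 4 * normConst := by
      refine (abs_add_le _ _).trans ?_
      have := mul_le_mul_of_nonneg_left hτ2 (by positivity : 0 ≤ 2 * normConst)
      rw [abs_one]
      linarith
    have hid : Real.exp d * (1 + r₁) * (1 + r₃) - 1 =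
        (Real.exp d - 1) * (1 + r₁) * (1 + r₃) + (r₃ * (1 + r₁) + r₁) := by ring
    rw [hid]
    calc |(Real.exp d - 1) * (1 + r₁) * (1 + r₃) + (r₃ * (1 + r₁) + r₁)| ≤
          |Real.exp d - 1| * |1 + r₁| * |1 + r₃| + (|r₃| * |1 + r₁| + |r₁|) := by
          refine (abs_add_le _ _).trans ?_
          rw [abs_mul, abs_mul, ← abs_mul r₃]
          gcongr
          exact abs_add_le _ _
      _ ≤ (2 * Real.exp 4 * τ) * (1 + 10 * localConst) * (1 + 4 * normConst) +
          ((2 * normConst * τ) * (1 + 10 * localConst) + 5 * localConst * τ) := by gcongr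
      _ = localLimitConst * τ := by unfold localLimitConst; ring
  · have h1 : 1 + r₁ = v / G := by rw [hr₁]; ring
    have h3 : 1 + r₃ = c * σ / V := by rw [hr₃]; ring
    have h4 : 1 + (Real.exp d * (1 + r₁) * (1 + r₃) - 1) = Real.exp d * (v / G) * (c * σ / V) := by
      rw [h1, h3]; ring
    rw [h4, hGd]
    have := (Real.exp_pos (-x ^ 2 / 2)).ne'
    have := (Real.exp_pos d).ne'
    field_simp

end IsSaddle

/-! ### The scale as a function of `n` -/

theorem one_le_lambertW_and_le_log {n : ℕ} (hn : 3 ≤ n) :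
    1 ≤ lambertW n ∧ lambertW n ≤ Real.log n := by
  have hn3 : (3 : ℝ) ≤ n := by exact_mod_cast hn
  have hn0 : (0 : ℝ) < n := by linarith
  have hspec := (lambertW_spec (x := n) (by linarith [Real.exp_pos (-1)])).2
  have hpos := lambertW_pos hn0
  have h1 : 1 ≤ lambertW n := by
    by_contra hlt
    rw [not_le] at hlt
    have h2 : Real.exp (lambertW n) ≤ Real.exp 1 := Real.exp_le_exp.2 hlt.le
    have h3 := Real.exp_one_lt_d9
    have h4 := Real.exp_pos (lambertW n)
    nlinarith
  refine ⟨h1, ?_⟩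
  rw [Real.le_log_iff_exp_le hn0]
  have h4 := Real.exp_pos (lambertW n)
  nlinarith

theorem sqrt_div_log_le_blockSigma {n : ℕ} (hn : 3 ≤ n) :
    √n / (2 * Real.log n) ≤ blockSigma n := by
  obtain ⟨h1, h2⟩ := one_le_lambertW_and_le_log hn
  unfold blockSigma
  apply Real.le_sqrt_of_sq_le
  rw [div_pow, Real.sq_sqrt (Nat.cast_nonneg n)]
  have h3 : 0 < lambertW n * (lambertW n + 1) := by nlinarith
  gcongr
  nlinarith

theorem tendsto_blockSigma : Tendsto blockSigma atTop atTop := by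
  have h1 : Tendsto (fun x : ℝ => Real.log x / x ^ (1 / 2 : ℝ)) atTop (𝓝 0) :=
    (isLittleO_log_rpow_atTop (by norm_num)).tendsto_div_nhds_zero
  have h2 : Tendsto (fun x : ℝ => Real.log x / x ^ (1 / 2 : ℝ)) atTop (𝓝[>] 0) := by
    refine tendsto_nhdsWithin_iff.2 ⟨h1, ?_⟩
    filter_upwards [eventually_gt_atTop 1] with x hx
    exact div_pos (Real.log_pos hx) (Real.rpow_pos_of_pos (by linarith) _)
  have h3 := (h2.inv_tendsto_nhdsGT_zero.const_mul_atTop (by norm_num : (0 : ℝ) < 1 / 2)).comp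
    tendsto_natCast_atTop_atTop
  refine tendsto_atTop_mono' _ ?_ h3
  filter_upwards [eventually_ge_atTop 3] with n hn
  refine le_trans (le_of_eq ?_) (sqrt_div_log_le_blockSigma hn)
  simp only [Function.comp, Pi.inv_apply]
  rw [inv_div, Real.sqrt_eq_rpow]
  ring

theorem isSaddle_of_le {n : ℕ} (hn : 3 ≤ n) (hσ : 4 ≤ blockSigma n) :
    IsSaddle n (lambertW n) (blockMu n) (blockSigma n) := by
  obtain ⟨h1, -⟩ := one_le_lambertW_and_le_log hn
  have hn3 : (3 : ℝ) ≤ n := by exact_mod_cast hn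
  have hspec := (lambertW_spec (x := n) (by linarith [Real.exp_pos (-1)])).2
  have hW : 0 < lambertW n := by linarith
  have hμ : blockMu n = Real.exp (lambertW n) := by
    rw [blockMu, div_eq_iff hW.ne']
    linarith
  refine ⟨h1, hσ, hμ, ?_, ?_⟩
  · have hs : blockSigma n ^ 2 = n / (lambertW n * (lambertW n + 1)) :=
      Real.sq_sqrt (by positivity)
    rw [hs, blockMu]
    field_simp
  · rw [blockMu]
    field_simp

theorem mainTheorem1 :
    (fun n : ℕ => ⨆ x : ℝ,
        |(uniformSetPartition n).real
            {π | ((numBlocks n π : ℝ) - blockMu n) / blockSigma n ≤ x} - stdNormalPhi x|)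
      =O[atTop] (fun n : ℕ => (n : ℝ) ^ (-(1 / 2) : ℝ) * Real.log n) ∧
    ∃ C : ℝ, ∀ ε : ℕ → ℝ, Tendsto ε atTop (𝓝 0) →
      ∀ᶠ n : ℕ in atTop, ∀ x : ℝ, |x| ≤ ε n * blockSigma n ^ (1 / 3 : ℝ) →
        ∃ r : ℝ, |r| ≤ C * ((1 + |x| ^ 3) / blockSigma n) ∧
          (uniformSetPartition n).real
              {π | (numBlocks n π : ℤ) = ⌊blockMu n + x * blockSigma n⌋} =
            Real.exp (-x ^ 2 / 2) / (√(2 * Real.pi) * blockSigma n) * (1 + r) := by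
  have hnc := normConst_pos
  constructor
  · refine Asymptotics.IsBigO.of_bound (2 * (2 * normConst + 1)) ?_
    filter_upwards [eventually_ge_atTop 3, tendsto_blockSigma.eventually_ge_atTop 4] with n hn hσ
    have hS := isSaddle_of_le hn hσ
    have hlog : 0 < Real.log n := by
      have := one_le_lambertW_and_le_log hn
      linarith [this.1, this.2]
    have hn0 : (0 : ℝ) < n := by exact_mod_cast (by omega : 0 < n)
    have hsq : 0 < √(n : ℝ) := Real.sqrt_pos.2 hn0
    have hr : (n : ℝ) ^ (-(1 / 2) : ℝ) = (√n)⁻¹ := by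
      rw [Real.rpow_neg hn0.le, Real.sqrt_eq_rpow]
    rw [hr, Real.norm_of_nonneg (Real.iSup_nonneg fun x => abs_nonneg _),
      Real.norm_of_nonneg (by positivity)]
    refine Real.iSup_le (fun x => (hS.abs_cdf_sub_le x).trans ?_) (by positivity)
    calc (2 * normConst + 1) / blockSigma n ≤ (2 * normConst + 1) / (√n / (2 * Real.log n)) := by
          gcongr
          exact sqrt_div_log_le_blockSigma hn
      _ = _ := by field_simp
  · refine ⟨localLimitConst, fun ε hε => ?_⟩
    filter_upwards [eventually_ge_atTop 3, tendsto_blockSigma.eventually_ge_atTop 4,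
      tendsto_blockSigma.eventually_ge_atTop (2 * normConst),
      hε.eventually (eventually_le_nhds (zero_lt_one' ℝ))] with n hn hσ hσK hε1 x hx
    have hσ0 : 0 ≤ blockSigma n := by linarith
    refine (isSaddle_of_le hn hσ).exists_local_limit hσK ?_
    have h1 : |x| ≤ blockSigma n ^ (1 / 3 : ℝ) :=
      hx.trans (mul_le_of_le_one_left (Real.rpow_nonneg hσ0 _) hε1)
    calc |x| ^ 3 ≤ (blockSigma n ^ (1 / 3 : ℝ)) ^ 3 := by gcongr
      _ = blockSigma n := by
        rw [← Real.rpow_natCast, ← Real.rpow_mul hσ0]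
        norm_num
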